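/- Let $r\ge 1$, $d\ge 1$, and let $P_1,\dots,P_r\subset\mathbb{R}^d$ be $d$-dimensional polytopes with vertex sets $V_1,\dots,V_r$. Let $e_1,\dots,e_r$ be an affine basis of $\mathbb{R}^{r-1}$ and identify $x\in V_i$ with the point $(e_i,x)\in\mathbb{R}^{r-1}\times\mathbb{R}^d$. For $\emptyset\neq R\subseteq[r]$ put $V_R=\bigcup_{i\in R}V_i$ and let $\mathcal{C}_R=\operatorname{conv}(V_R)$ be the Cayley polytope of the $P_i$, $i\in R$. Assume that every face of $\mathcal{C}_{[r]}$ is a simplex, except possibly the faces $\mathcal{C}_S$, $\emptyset\ne S\subseteq[r]$. Let $\mathcal{F}_R$ be the set of proper faces of $\mathcal{C}_R$ having at least one vertex in each $V_i$, $i\in R$ (the mixed faces), and let $\mathcal{K}_R$ be the simplicial complex consisting of all faces (including $\emptyset$) of members of $\mathcal{F}_R$. For $v\in V_R$ let $\mathcal{K}_R/v$ be the link of $v$ in $\mathcal{K}_R$, and let $\mathcal{F}_R/v$ be the set of those $G\in\mathcal{K}_R/v$ with $\operatorname{conv}(G\cup\{v\})\in\mathcal{F}_R$. For a set $\mathcal{Y}$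 of faces let $f_k(\mathcal{Y})$ be the number of its members of dimension $k$ (with $\dim\emptyset=-1$), except that by convention $f_{-1}(\mathcal{F}_R)=(-1)^{|R|-1}$. If $\delta-1$ is the maximal dimension of a member of $\mathcal{Y}$, put $$h_k(\mathcal{Y})=\sum_{i=0}^{\delta}(-1)^{k-i}\binom{\delta-i}{\delta-k}f_{i-1}(\mathcal{Y})\quad(0\le k\le\delta),\qquad h(\mathcal{Y};t)=\sum_{k=0}^{\delta}h_k(\mathcal{Y})\,t^{\delta-k},$$ $h_k(\mathcal{Y})=0$ for all other $k$, and $g_k^{(m)}(\mathcal{Y})=\sum_{i=0}^m(-1)^i\binom{m}{i}h_{k-i}(\mathcal{Y})$. Then for every $\emptyset\ne R\subseteq[r]$ $$(d+|R|-1)\,h(\mathcal{F}_R;t)+(1-t)\,h'(\mathcal{F}_R;t)=\sum_{v\in V_R}h(\mathcal{F}_R/v;t),$$ and for all $0\le k\le d+|R|-2$ $$(k+1)h_{k+1}(\mathcal{F}_R)+(d+|R|-1-k)h_k(\mathcal{F}_R)=\sum_{v\in V_R}h_k(\mathcal{F}_R/v) =\sum_{\emptyset\ne S\subseteq R}(-1)^{|R|-|S|}\sum_{v\in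 V_S}g_k^{(|R|-|S|)}(\mathcal{K}_S/v).$$ -/

import Mathlib

open Polynomial

noncomputable section

namespace Cayley

/-! ### Polytopes, faces, dimensions -/

section General

variable {E : Type*} [AddCommGroup E] [Module ℝ E] [TopologicalSpace E]

/-- `F` is a face of the polytope `P`: the empty set, `P` itself, or the intersection of `P` with
a supporting hyperplane. -/
def IsFace (P F : Set E) : Prop := IsExposed ℝ P F

open Classical in
/-- The dimension of the affine span of `F`; it is `-1` for the empty set. -/
def polyDim (F : Set E) : ℤ :=
  if F = ∅ then -1 else (Module.finrank ℝ (vectorSpan ℝ F) : ℤ)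

/-- `F` is a (possibly empty) simplex. -/
def IsSimplex (F : Set E) : Prop :=
  ∃ s : Finset E, AffineIndependent ℝ ((↑) : s → E) ∧ F = convexHull ℝ (s : Set E)

/-- `P` is a polytope of dimension `d` and `V` is the set of its vertices. -/
structure IsPolytope (d : ℕ) (P : Set E) (V : Finset E) : Prop where
  eq_hull : P = convexHull ℝ (V : Set E)
  vertices : P.extremePoints ℝ = (V : Set E)
  dim : polyDim P = d

/-- The dimension of a set of faces: the maximum of the dimensions of its members. -/
def facesDim (Y : Set (Set E)) : ℤ := sSup (polyDim '' Y)

/-- The number of `k`-dimensional members of a set of faces. -/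
def numFaces (Y : Set (Set E)) (k : ℤ) : ℤ := ({F ∈ Y | polyDim F = k}.ncard : ℤ)

/-- The link of `v` in a complex `K`: the faces not containing `v` of the star of `v`, the star
consisting of the faces of `K` that contain `v`, and their faces. -/
def link (K : Set (Set E)) (v : E) : Set (Set E) :=
  {G | v ∉ G ∧ ∃ F ∈ K, v ∈ F ∧ IsFace F G}

end General

/-! ### h-vectors

Throughout, `f k` is the number of `k`-dimensional faces (`k ≥ -1`) and `δ - 1` is the dimension. -/

/-- `h_k = ∑_{i=0}^{δ} (-1)^{k-i} (δ-i choose δ-k) f_{i-1}` for `0 ≤ k ≤ δ`, and `h_k = 0` for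
`k > δ`. The binomial coefficient vanishes for `i > k`. -/
def hNum (δ : ℕ) (f : ℤ → ℤ) (k : ℕ) : ℤ :=
  if k ≤ δ then
    ∑ i ∈ Finset.range (δ + 1), (-1) ^ (k - i) * ((δ - i).choose (δ - k) : ℤ) * f ((i : ℤ) - 1)
  else 0

/-- The generating function `h(t) = ∑_{k=0}^{δ} h_k t^{δ-k}`. -/
def hGen (δ : ℕ) (f : ℤ → ℤ) : ℤ[X] :=
  ∑ k ∈ Finset.range (δ + 1), C (hNum δ f k) * X ^ (δ - k)

/-- The `m`-th order backward difference of a sequence `h_0, h_1, …`, extended by `h_{-1} = 0`. -/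
def backDiff (h : ℕ → ℤ) : ℕ → ℕ → ℤ
  | 0, k => h k
  | m + 1, 0 => backDiff h m 0
  | m + 1, k + 1 => backDiff h m (k + 1) - backDiff h m k

section Faces

variable {E : Type*} [AddCommGroup E] [Module ℝ E] [TopologicalSpace E]

/-- `h_k` of a set of faces `Y`. -/
def hFaces (Y : Set (Set E)) (k : ℕ) : ℤ := hNum (facesDim Y + 1).toNat (numFaces Y) k

/-- The generating function of the h-vector of a set of faces `Y`. -/
def hFacesGen (Y : Set (Set E)) : ℤ[X] := hGen (facesDim Y + 1).toNat (numFaces Y)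

/-- The `m`-order g-vector of a set of faces `Y`. -/
def gFaces (Y : Set (Set E)) (m k : ℕ) : ℤ := backDiff (hFaces Y) m k

end Faces

/-! ### The Cayley polytope and its mixed faces -/

/-- The space `ℝ^{r-1} × ℝ^d`. -/
abbrev Space (r d : ℕ) : Type := EuclideanSpace ℝ (Fin (r - 1)) × EuclideanSpace ℝ (Fin d)

section Mixed

variable {r d : ℕ} (e : AffineBasis (Fin r) ℝ (EuclideanSpace ℝ (Fin (r - 1))))
  (V : Fin r → Finset (EuclideanSpace ℝ (Fin d)))

open Classical in
/-- `V_R`: the union over `i ∈ R` of the embedded vertex sets `{(e_i, x) | x ∈ V_i}`. -/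
def vertexSet (R : Finset (Fin r)) : Finset (Space r d) :=
  R.biUnion fun i => (V i).image fun x => (e i, x)

/-- The Cayley polytope `C_R` of the polytopes with vertex sets `V_i`, `i ∈ R`. -/
def cayleyPolytope (R : Finset (Fin r)) : Set (Space r d) :=
  convexHull ℝ (vertexSet e V R : Set (Space r d))

/-- All faces of `C_{[r]}` are simplices, except possibly the trivial faces `C_S`. -/
def AsSimplicialAsPossible : Prop :=
  ∀ F : Set (Space r d), IsFace (cayleyPolytope e V Finset.univ) F →
    (∀ S : Finset (Fin r), S.Nonempty → F ≠ cayleyPolytope e V S) → IsSimplex F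

/-- `F_R`: the proper faces of `C_R` with at least one vertex from each `V_i`, `i ∈ R`. -/
def mixedFaces (R : Finset (Fin r)) : Set (Set (Space r d)) :=
  {F | IsFace (cayleyPolytope e V R) F ∧ F ≠ cayleyPolytope e V R ∧
    ∀ i ∈ R, ∃ x ∈ V i, ((e i, x) : Space r d) ∈ F}

/-- `K_R`: the closure of `F_R` under taking faces (including the empty face). -/
def mixedComplex (R : Finset (Fin r)) : Set (Set (Space r d)) :=
  {G | ∃ F ∈ mixedFaces e V R, IsFace F G}

/-- `F_R / v`: the faces in the link of `v` in `K_R` whose join with `v` lies in `F_R`. -/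
def mixedLink (R : Finset (Fin r)) (v : Space r d) : Set (Set (Space r d)) :=
  {G ∈ link (mixedComplex e V R) v | convexHull ℝ (insert v G) ∈ mixedFaces e V R}

/-- The f-vector of `F_R`, with the convention `f_{-1}(F_R) = (-1)^{|R|-1}`. -/
def fMixed (R : Finset (Fin r)) (k : ℤ) : ℤ :=
  if k = -1 then (-1) ^ (R.card - 1) else numFaces (mixedFaces e V R) k

/-- `h_k(F_R)`. -/
def hMixed (R : Finset (Fin r)) (k : ℕ) : ℤ :=
  hNum (facesDim (mixedFaces e V R) + 1).toNat (fMixed e V R) k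

/-- The generating function `h(F_R; t)`. -/
def hMixedGen (R : Finset (Fin r)) : ℤ[X] :=
  hGen (facesDim (mixedFaces e V R) + 1).toNat (fMixed e V R)

end Mixed

end Cayley

end

/-!
The mixed faces are controlled by the nonzero functionals on `ℝ^d`. For a functional `l` and a set
`T` of indices let `M_T(l)` (`maxVertices`) consist of the vertices `(e_i, x)`, `i ∈ T`, for which
`x` maximizes `l` over `V_i`. Since the `e_i` are affinely independent, a functional on the ambient
space of the Cayley polytope amounts to a functional on `ℝ^d` together with an arbitrary constant
for each summand. Hence the mixed faces of `C_R` are the convex hulls of the sets `M_R(l)`, `l ≠ 0`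
(`mem_mixedFaces_iff`). For nonempty `T` and `l ≠ 0`, the hull of `M_T(l)` is a face of the full
Cayley polytope other than the `C_S`, so that it is a simplex (`affineIndependent_maxVertices`), and
the assertion becomes one about families of finite sets. Two facts about them are needed.

* Every nonempty subset of `M_R(l)` is of the form `M_T(l')` for a unique `T ⊆ R`: perturb `l`
  towards a functional exposing the subset (`exists_maxVertices_eq_of_subset`). Therefore, in
  dimensions `j ≥ 0`, `f_j(K_R) = ∑_{T ⊆ R} f_j(F_T)` (`sizeCount_complexVertexSets`), and Möbius
  inversion gives `f_j(F_R) = ∑_S (-1)^{|R|-|S|} f_j(K_S)` (`sizeCount_mixedVertexSets`).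
* Every `M_R(l)` is contained in one with `d + |R| - 1` elements, and none has more: if `M_R(l)` is
  smaller, there is a direction other than `l` that is constant on each of its parts, and `l` can be
  rotated in that direction until a further vertex is reached (`exists_maxVertices_card_eq`). This
  determines the dimensions that enter the `h`-vectors of `F_R` and of all links.

With `δ = d + |R| - 1`, the generating function is `h(F_R; t) = ∑_i f_{i-1} (t-1)^{δ-i}`
(`hGen_eq_sum`), and the operator `δ + (1-t) d/dt` multiplies the `i`-th term by `i`. In particular
it kills the term with the conventional value `f_{-1}(F_R)`. As a `j`-face is a simplex with `j + 1`
vertices, `∑_v f_{j-1}(F_R/v) = (j+1) f_j(F_R)`, which gives the first identity, and the second by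
comparison of coefficients. The same count for `K_S` together with the Möbius inversion yields the
third: taking the `m`-th backward difference of `h`-numbers has the same effect as computing them
for a dimension larger by `m` (`backDiff_hNum`).
-/

namespace Cayley

/-! ### Faces of polytopes and simplices -/

section ConvexGeometry

theorem polyDim_simplex {E : Type*} [AddCommGroup E] [Module ℝ E] {s : Finset E}
    (hs : AffineIndependent ℝ ((↑) : s → E)) :
    polyDim (convexHull ℝ (s : Set E)) = s.card - 1 := by
  unfold polyDim
  rcases s.eq_empty_or_nonempty with rfl | hne
  · simp
  · rw [if_neg (by simpa using hne.ne_empty)]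
    have hc : Fintype.card s = (s.card - 1) + 1 := by
      have := hne.card_pos
      simp; omega
    have h1 := hs.finrank_vectorSpan hc
    rw [Subtype.range_coe_subtype] at h1
    have : vectorSpan ℝ (convexHull ℝ (s : Set E)) = vectorSpan ℝ (s : Set E) := by
      rw [← direction_affineSpan, affineSpan_convexHull, direction_affineSpan]
    rw [this]
    have h2 : Module.finrank ℝ (vectorSpan ℝ (s : Set E)) = s.card - 1 := h1
    rw [h2]
    have := hne.card_pos
    omega

variable {E : Type*} [AddCommGroup E] [Module ℝ E] [TopologicalSpace E]

open Classical in
/-- The points of the finite set `W` at which the functional `l` attains its maximum over `W`. -/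
noncomputable def maximizers (l : StrongDual ℝ E) (W : Finset E) : Finset E :=
  W.filter fun x => ∀ y ∈ W, l y ≤ l x

theorem mem_maximizers {l : StrongDual ℝ E} {W : Finset E} {x : E} :
    x ∈ maximizers l W ↔ x ∈ W ∧ ∀ y ∈ W, l y ≤ l x := by
  simp [maximizers]

theorem maximizers_subset (l : StrongDual ℝ E) (W : Finset E) : maximizers l W ⊆ W :=
  Finset.filter_subset _ _

theorem maximizers_nonempty (l : StrongDual ℝ E) {W : Finset E} (hW : W.Nonempty) :
    (maximizers l W).Nonempty := by
  obtain ⟨x, hx, h⟩ := W.exists_max_image l hW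
  exact ⟨x, mem_maximizers.2 ⟨hx, h⟩⟩

theorem eq_of_mem_maximizers {l : StrongDual ℝ E} {W : Finset E} {x y : E}
    (hx : x ∈ maximizers l W) (hy : y ∈ maximizers l W) : l x = l y :=
  le_antisymm ((mem_maximizers.1 hy).2 x (mem_maximizers.1 hx).1)
    ((mem_maximizers.1 hx).2 y (mem_maximizers.1 hy).1)

theorem le_of_mem_convexHull (l : StrongDual ℝ E) {W : Set E} {m : ℝ} (h : ∀ y ∈ W, l y ≤ m)
    {x : E} (hx : x ∈ convexHull ℝ W) : l x ≤ m :=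
  convexHull_min (t := {x | l x ≤ m}) h (convex_halfSpace_le l.toLinearMap.isLinear m) hx

theorem eq_of_mem_convexHull (l : StrongDual ℝ E) {W : Set E} {m : ℝ} (h : ∀ y ∈ W, l y = m)
    {x : E} (hx : x ∈ convexHull ℝ W) : l x = m :=
  convexHull_min (t := {x | l x = m}) h (convex_hyperplane l.toLinearMap.isLinear m) hx

/-- The face of a polytope on which a functional is maximal is spanned by the maximizers among the
points spanning the polytope. -/
theorem toExposed_convexHull (l : StrongDual ℝ E) (W : Finset E) :
    l.toExposed (convexHull ℝ (W : Set E)) = convexHull ℝ (maximizers l W : Set E) := by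
  classical
  ext x
  constructor
  · rintro ⟨hx, hmax⟩
    obtain ⟨w, hw0, hw1, rfl⟩ := Finset.mem_convexHull.1 hx
    rw [← Finset.centerMass_filter_ne_zero]
    refine Finset.centerMass_mem_convexHull _ (fun y hy => hw0 y (Finset.mem_filter.1 hy).1) ?_ ?_
    · rw [Finset.sum_filter_ne_zero, hw1]; exact one_pos
    · intro z hz
      obtain ⟨hzW, hz⟩ := Finset.mem_filter.1 hz
      set x := W.centerMass w id with hxdef
      have hle : ∀ y ∈ W, l y ≤ l x := fun y hy => hmax y (subset_convexHull ℝ _ hy)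
      have hsum : ∑ y ∈ W, w y * (l x - l y) = 0 := by
        have : l x = ∑ y ∈ W, w y * l y := by
          rw [hxdef, Finset.centerMass_eq_of_sum_1 _ _ hw1, map_sum]
          simp
        simp only [mul_sub, Finset.sum_sub_distrib, ← Finset.sum_mul, hw1, one_mul, ← this, sub_self]
      have hzero := (Finset.sum_eq_zero_iff_of_nonneg
        (fun y hy => mul_nonneg (hw0 y hy) (sub_nonneg.2 (hle y hy)))).1 hsum z hzW
      have hlz : l x = l z := by
        rcases mul_eq_zero.1 hzero with h | h
        · exact absurd h hz
        · linarith
      exact mem_maximizers.2 ⟨hzW, fun y hy => hlz ▸ hle y hy⟩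
  · intro hx
    have hne : (maximizers l W).Nonempty := by
      simpa using convexHull_nonempty_iff.1 ⟨x, hx⟩
    obtain ⟨z, hz⟩ := hne
    refine ⟨convexHull_mono (by exact_mod_cast maximizers_subset l W) hx, fun y hy => ?_⟩
    rw [eq_of_mem_convexHull l (fun y hy => eq_of_mem_maximizers hy hz) hx]
    exact le_of_mem_convexHull l (mem_maximizers.1 hz).2 hy

theorem isFace_convexHull_maximizers (l : StrongDual ℝ E) (W : Finset E) :
    IsFace (convexHull ℝ (W : Set E)) (convexHull ℝ (maximizers l W : Set E)) := by
  rw [← toExposed_convexHull]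
  exact ContinuousLinearMap.toExposed.isExposed

theorem IsFace.exists_maximizers {W : Finset E} {F : Set E}
    (hF : IsFace (convexHull ℝ (W : Set E)) F) (hne : F.Nonempty) :
    ∃ l : StrongDual ℝ E, F = convexHull ℝ (maximizers l W : Set E) := by
  obtain ⟨l, hl⟩ := hF hne
  exact ⟨l, hl.trans (toExposed_convexHull l W)⟩

/-- For a small step in direction `l'`, the maximizers of `l + ε l'` are the maximizers of `l'`
among those of `l`. -/
theorem eventually_maximizers_add_smul (l l' : StrongDual ℝ E) [IsTopologicalAddGroup E]
    [ContinuousSMul ℝ E] (W : Finset E) :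
    ∀ᶠ ε : ℝ in nhdsWithin 0 (Set.Ioi 0),
      maximizers (l + ε • l') W = maximizers l' (maximizers l W) := by
  have key : ∀ x ∈ W, ∀ y ∈ W, ∀ᶠ ε : ℝ in nhdsWithin 0 (Set.Ioi 0),
      (l x < l y → l x + ε * l' x < l y + ε * l' y) := by
    intro x _ y _
    by_cases h : l x < l y
    · have h1 : Filter.Tendsto (fun ε : ℝ => (l y + ε * l' y) - (l x + ε * l' x))
          (nhdsWithin 0 (Set.Ioi 0)) (nhds ((l y + 0 * l' y) - (l x + 0 * l' x))) :=
        Filter.Tendsto.mono_left (Continuous.tendsto (by fun_prop) 0) nhdsWithin_le_nhds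
      filter_upwards [h1.eventually (lt_mem_nhds (a := 0) (by linarith))] with ε hε _
      linarith
    · simp [h]
  have key' := (Filter.eventually_all_finset W).2 fun x hx =>
    (Filter.eventually_all_finset W).2 (key x hx)
  filter_upwards [key', self_mem_nhdsWithin] with ε hε (hpos : 0 < ε)
  ext x
  simp only [mem_maximizers, add_apply, smul_apply, smul_eq_mul]
  constructor
  · rintro ⟨hx, h⟩
    have hx' : ∀ y ∈ W, l y ≤ l x := by
      intro y hy
      by_contra! hlt
      linarith [h y hy, hε x hx y hy hlt]
    refine ⟨⟨hx, hx'⟩, fun y hy => ?_⟩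
    have h1 := h y hy.1
    have h2 := hx' y hy.1
    have h3 := hy.2 x hx
    have : ε * l' y ≤ ε * l' x := by linarith
    exact le_of_mul_le_mul_left this hpos
  · rintro ⟨⟨hx, hx'⟩, h⟩
    refine ⟨hx, fun y hy => ?_⟩
    rcases (hx' y hy).lt_or_eq with hlt | heq
    · exact (hε y hy x hx hlt).le
    · have := h y ⟨hy, fun z hz => heq ▸ hx' z hz⟩
      have := mul_le_mul_of_nonneg_left this hpos.le
      linarith

theorem eventually_add_smul_ne_zero [IsTopologicalAddGroup E] [ContinuousSMul ℝ E]
    {l : StrongDual ℝ E} (hl : l ≠ 0) (l' : StrongDual ℝ E) :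
    ∀ᶠ ε : ℝ in nhdsWithin 0 (Set.Ioi 0), l + ε • l' ≠ 0 := by
  obtain ⟨y, hy⟩ : ∃ y, l y ≠ 0 := by
    by_contra! h
    exact hl (ContinuousLinearMap.ext h)
  have h1 : Filter.Tendsto (fun ε : ℝ => l y + ε * l' y) (nhdsWithin 0 (Set.Ioi 0))
      (nhds (l y + 0 * l' y)) :=
    Filter.Tendsto.mono_left (Continuous.tendsto (by fun_prop) 0) nhdsWithin_le_nhds
  filter_upwards [h1.eventually_ne (by simpa using hy)] with ε hε h0
  exact hε (by simpa using DFunLike.congr_fun h0 y)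

variable [IsTopologicalAddGroup E] [ContinuousSMul ℝ E] [T2Space E] [FiniteDimensional ℝ E]

/-- An arbitrary function on an affinely independent family is the restriction of a continuous
affine functional. -/
theorem exists_dual_eq_of_affineIndependent {ι : Type*} {p : ι → E} (hp : AffineIndependent ℝ p)
    (f : ι → ℝ) : ∃ (l : StrongDual ℝ E) (c : ℝ), ∀ i, l (p i) + c = f i := by
  rcases isEmpty_or_nonempty ι with h | ⟨⟨i₀⟩⟩
  · exact ⟨0, 0, fun i => h.elim i⟩
  · have hli := (affineIndependent_iff_linearIndependent_vsub ℝ p i₀).1 hp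
    obtain ⟨g, hg⟩ := LinearMap.exists_extend
      ((Module.Basis.span hli).constr ℝ fun i : {x // x ≠ i₀} => f i - f i₀)
    refine ⟨LinearMap.toContinuousLinearMap g, f i₀ - g (p i₀), fun i => ?_⟩
    by_cases hi : i = i₀
    · subst hi; simp
    · have h1 := LinearMap.congr_fun hg (Module.Basis.span hli ⟨i, hi⟩)
      rw [Module.Basis.constr_basis] at h1
      simp only [LinearMap.comp_apply, Submodule.subtype_apply, Module.Basis.span_apply,
        vsub_eq_sub, map_sub] at h1
      simp only [LinearMap.coe_toContinuousLinearMap']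
      linarith

/-- A set `t` of vertices of a simplex is exposed by an affine functional with values `0` on `t` and
`-1` on the remaining vertices. -/
theorem exists_dual_maximizers_eq {s t : Finset E} (hs : AffineIndependent ℝ ((↑) : s → E))
    (hts : t ⊆ s) (ht : t.Nonempty) : ∃ (l : StrongDual ℝ E) (c : ℝ),
      (∀ x ∈ t, l x + c = 0) ∧ (∀ x ∈ s, x ∉ t → l x + c = -1) ∧ maximizers l s = t := by
  classical
  obtain ⟨l, c, hl⟩ := exists_dual_eq_of_affineIndependent hs
    (fun x => if (x : E) ∈ t then 0 else -1)
  have h1 : ∀ x ∈ t, l x + c = 0 := fun x hx => by simpa [hx] using hl ⟨x, hts hx⟩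
  have h2 : ∀ x ∈ s, x ∉ t → l x + c = -1 := fun x hx hxt => by simpa [hxt] using hl ⟨x, hx⟩
  refine ⟨l, c, h1, h2, ?_⟩
  ext x
  rw [mem_maximizers]
  obtain ⟨z, hz⟩ := ht
  constructor
  · rintro ⟨hx, h⟩
    by_contra hxt
    linarith [h z (hts hz), h1 z hz, h2 x hx hxt]
  · intro hx
    refine ⟨hts hx, fun y hy => ?_⟩
    by_cases hyt : y ∈ t
    · linarith [h1 x hx, h1 y hyt]
    · linarith [h1 x hx, h2 y hy hyt]

/-- The faces of a simplex are spanned by the subsets of its vertex set. -/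
theorem isFace_simplex_iff {s : Finset E} (hs : AffineIndependent ℝ ((↑) : s → E)) {G : Set E} :
    IsFace (convexHull ℝ (s : Set E)) G ↔ ∃ t ⊆ s, G = convexHull ℝ (t : Set E) := by
  constructor
  · intro hG
    rcases G.eq_empty_or_nonempty with rfl | hne
    · exact ⟨∅, Finset.empty_subset _, by simp⟩
    · obtain ⟨l, hl⟩ := hG.exists_maximizers hne
      exact ⟨_, maximizers_subset l s, hl⟩
  · rintro ⟨t, hts, rfl⟩
    rcases t.eq_empty_or_nonempty with rfl | hne
    · simpa using! isExposed_empty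
    · obtain ⟨l, -, -, -, hl⟩ := exists_dual_maximizers_eq hs hts hne
      rw [← hl]
      exact isFace_convexHull_maximizers l s

/-- The vertices of a simplex are extreme points. -/
theorem subset_extremePoints_simplex {s : Finset E} (hs : AffineIndependent ℝ ((↑) : s → E)) :
    (s : Set E) ⊆ (convexHull ℝ (s : Set E)).extremePoints ℝ := by
  intro x hx
  have : IsFace (convexHull ℝ (s : Set E)) {x} :=
    (isFace_simplex_iff hs).2 ⟨{x}, by simpa using hx, by simp⟩
  simpa using IsExposed.isExtreme this

end ConvexGeometry

/-! ### `h`-numbers and their generating functions -/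

section HNumbers

theorem hNum_congr {δ : ℕ} {f g : ℤ → ℤ} (h : ∀ i : ℕ, i ≤ δ → f ((i : ℤ) - 1) = g ((i : ℤ) - 1)) :
    hNum δ f = hNum δ g := by
  funext k
  unfold hNum
  split_ifs
  · refine Finset.sum_congr rfl fun i hi => ?_
    rw [h i (by simpa [Nat.lt_succ_iff] using hi)]
  · rfl

theorem hNum_sum_mul {ι : Type*} (s : Finset ι) (c : ι → ℤ) (f : ι → ℤ → ℤ) (δ k : ℕ) :
    hNum δ (fun j => ∑ a ∈ s, c a * f a j) k = ∑ a ∈ s, c a * hNum δ (f a) k := by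
  unfold hNum
  split_ifs
  · simp only [Finset.mul_sum]
    rw [Finset.sum_comm]
    exact Finset.sum_congr rfl fun a _ => Finset.sum_congr rfl fun i _ => by ring
  · simp

theorem hNum_sum {ι : Type*} (s : Finset ι) (f : ι → ℤ → ℤ) (δ k : ℕ) :
    hNum δ (fun j => ∑ a ∈ s, f a j) k = ∑ a ∈ s, hNum δ (f a) k := by
  simpa using hNum_sum_mul s (fun _ => 1) f δ k

theorem hNum_zero (δ : ℕ) : hNum δ (fun _ => 0) = fun _ => 0 := by
  funext k
  simp [hNum]

theorem coeff_hGen (δ : ℕ) (f : ℤ → ℤ) (m : ℕ) :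
    (hGen δ f).coeff m = if m ≤ δ then hNum δ f (δ - m) else 0 := by
  unfold hGen
  rw [finsetSum_coeff]
  simp only [coeff_C_mul, coeff_X_pow, mul_ite, mul_one, mul_zero]
  split_ifs with h
  · rw [Finset.sum_eq_single (δ - m)]
    · rw [if_pos (by omega)]
    · intro k hk hne
      rw [Finset.mem_range] at hk
      rw [if_neg (by omega)]
    · intro h'
      exact absurd (Finset.mem_range.2 (by omega)) h'
  · refine Finset.sum_eq_zero fun k hk => ?_
    rw [if_neg (by omega)]

/-- The generating function of the `h`-numbers is the substitution of `t - 1` for `t` in the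
generating function of the face numbers. -/
theorem hGen_eq_sum (δ : ℕ) (f : ℤ → ℤ) :
    hGen δ f = ∑ i ∈ Finset.range (δ + 1), C (f ((i : ℤ) - 1)) * (X - 1) ^ (δ - i) := by
  ext m
  rw [coeff_hGen, finsetSum_coeff]
  have hX : (X - 1 : ℤ[X]) = X + C (-1) := by simp [sub_eq_add_neg]
  simp only [coeff_C_mul, hX, coeff_X_add_C_pow]
  split_ifs with h
  · rw [hNum, if_pos (Nat.sub_le _ _)]
    refine Finset.sum_congr rfl fun i _ => ?_
    rw [Nat.sub_sub_self h, Nat.sub_right_comm]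
    ring
  · refine (Finset.sum_eq_zero fun i _ => ?_).symm
    rw [Nat.choose_eq_zero_of_lt (by omega)]
    simp

theorem hNum_eq_coeff {δ k : ℕ} (f : ℤ → ℤ) (hk : k ≤ δ) :
    hNum δ f k = (hGen δ f).coeff (δ - k) := by
  rw [coeff_hGen, if_pos (Nat.sub_le _ _), Nat.sub_sub_self hk]

theorem hGen_sum {ι : Type*} (s : Finset ι) (f : ι → ℤ → ℤ) (δ : ℕ) :
    hGen δ (fun j => ∑ a ∈ s, f a j) = ∑ a ∈ s, hGen δ (f a) := by
  simp only [hGen_eq_sum, map_sum, Finset.sum_mul]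
  exact Finset.sum_comm

theorem hGen_succ (δ : ℕ) (f : ℤ → ℤ) :
    hGen (δ + 1) f = (X - 1) * hGen δ f + C (f δ) := by
  rw [hGen_eq_sum, hGen_eq_sum, Finset.sum_range_succ, Finset.mul_sum]
  congr 1
  · refine Finset.sum_congr rfl fun i hi => ?_
    rw [Finset.mem_range] at hi
    rw [show δ + 1 - i = (δ - i) + 1 by omega, pow_succ]
    ring
  · simp

theorem hNum_eq_zero {δ k : ℕ} (f : ℤ → ℤ) (h : δ < k) : hNum δ f k = 0 := by
  rw [hNum, if_neg (by omega)]

theorem hNum_succ_zero {δ : ℕ} {f : ℤ → ℤ} (hf : f δ = 0) :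
    hNum (δ + 1) f 0 = hNum δ f 0 := by
  rw [hNum_eq_coeff f (Nat.zero_le _), hNum_eq_coeff f (Nat.zero_le _), hGen_succ, hf]
  simp [sub_mul, coeff_X_mul, coeff_hGen]

/-- If no face has dimension `δ`, computing the `h`-numbers with `δ + 1` instead of `δ` amounts to
taking backward differences. -/
theorem hNum_succ_succ {δ : ℕ} {f : ℤ → ℤ} (hf : f δ = 0) (k : ℕ) :
    hNum (δ + 1) f (k + 1) = hNum δ f (k + 1) - hNum δ f k := by
  rcases lt_trichotomy k δ with h | rfl | h
  · rw [hNum_eq_coeff f (by omega), hNum_eq_coeff f (by omega), hNum_eq_coeff f (by omega),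
      hGen_succ, hf, show δ + 1 - (k + 1) = (δ - (k + 1)) + 1 by omega,
      show δ - k = (δ - (k + 1)) + 1 by omega]
    simp [sub_mul, coeff_X_mul]
  · rw [hNum_eq_coeff f le_rfl, hNum_eq_coeff f le_rfl, hNum_eq_zero f (Nat.lt_succ_self _),
      hGen_succ, hf]
    simp [sub_mul]
  · rw [hNum_eq_zero f (by omega), hNum_eq_zero f (by omega), hNum_eq_zero f (by omega), sub_zero]

theorem backDiff_hNum {δ : ℕ} {f : ℤ → ℤ} (hf : ∀ j : ℕ, δ ≤ j → f j = 0) (m k : ℕ) :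
    backDiff (hNum δ f) m k = hNum (δ + m) f k := by
  induction m generalizing k with
  | zero => rfl
  | succ m ih =>
    cases k with
    | zero => rw [backDiff, ih, ← add_assoc, hNum_succ_zero (hf _ (Nat.le_add_right _ _))]
    | succ k =>
      rw [backDiff, ih, ih, ← add_assoc, hNum_succ_succ (hf _ (Nat.le_add_right _ _))]

/-- If `g` counts the pairs consisting of a face and one of its vertices, the generating function
of `g` is obtained from that of `f` by a first-order differential operator. -/
theorem hGen_derivative {δ : ℕ} {f g : ℤ → ℤ}
    (h : ∀ j : ℕ, j ≤ δ → g ((j : ℤ) - 1) = ((j : ℤ) + 1) * f j) :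
    C ((δ : ℤ) + 1) * hGen (δ + 1) f + (1 - X) * derivative (hGen (δ + 1) f) = hGen δ g := by
  have hterm : ∀ (c : ℤ) (n : ℕ), (1 - X) * derivative (C c * (X - 1) ^ n) =
      - C ((n : ℤ) * c) * (X - 1) ^ n := by
    intro c n
    cases n with
    | zero => simp
    | succ n =>
      rw [derivative_C_mul, derivative_pow]
      simp only [derivative_sub, derivative_X, derivative_one, map_mul, map_natCast]
      simp only [add_tsub_cancel_right, sub_zero, mul_one]
      ring
  rw [hGen_eq_sum (δ + 1), hGen_eq_sum δ, derivative_sum, Finset.mul_sum, Finset.mul_sum,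
    ← Finset.sum_add_distrib, Finset.sum_range_succ']
  simp only [hterm]
  -- The term of `f (-1)` is annihilated.
  have h0 : C ((δ : ℤ) + 1) * (C (f (((0 : ℕ) : ℤ) - 1)) * (X - 1 : ℤ[X]) ^ (δ + 1 - 0)) +
      -C (((δ + 1 - 0 : ℕ) : ℤ) * f (((0 : ℕ) : ℤ) - 1)) * (X - 1) ^ (δ + 1 - 0) = 0 := by
    rw [map_mul, Nat.sub_zero]; push_cast; ring
  rw [h0, add_zero]
  refine Finset.sum_congr rfl fun j hj => ?_
  have hj' : j ≤ δ := by simpa [Nat.lt_succ_iff] using hj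
  rw [h j hj', Nat.add_sub_add_right, Nat.cast_sub hj']
  have : (((j + 1 : ℕ) : ℤ) - 1) = j := by push_cast; ring
  rw [this]
  simp only [map_mul, map_sub, map_add]
  ring

theorem hNum_derivative {δ : ℕ} {f g : ℤ → ℤ}
    (h : ∀ j : ℕ, j ≤ δ → g ((j : ℤ) - 1) = ((j : ℤ) + 1) * f j) {k : ℕ} (hk : k ≤ δ) :
    ((k : ℤ) + 1) * hNum (δ + 1) f (k + 1) + ((δ : ℤ) + 1 - k) * hNum (δ + 1) f k
      = hNum δ g k := by
  rw [hNum_eq_coeff g hk, ← hGen_derivative h, hNum_eq_coeff f (by omega),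
    hNum_eq_coeff f (by omega), sub_mul (1 : ℤ[X]), one_mul, Nat.add_sub_add_right,
    show δ + 1 - k = (δ - k) + 1 by omega]
  rw [coeff_add, coeff_sub, coeff_C_mul, coeff_derivative]
  obtain ⟨n, rfl⟩ := Nat.exists_eq_add_of_le hk
  rw [Nat.add_sub_cancel_left]
  cases n with
  | zero => simp
  | succ n => rw [coeff_X_mul, coeff_derivative]; push_cast; ring

end HNumbers

/-! ### Counting in families of finite sets -/

section Counting

open Finset

/-- Counting incident pairs of a point and a member of size `j + 1` of a family of finite sets. -/
theorem sum_card_memberSubfamily {α : Type*} [DecidableEq α] {V : Finset α}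
    {𝒜 : Finset (Finset α)} (h𝒜 : ∀ M ∈ 𝒜, M ⊆ V) (j : ℕ) :
    ∑ v ∈ V, #{N ∈ 𝒜.memberSubfamily v | #N = j} = (j + 1) * #{M ∈ 𝒜 | #M = j + 1} := by
  have h1 : ∀ v ∈ V, #{N ∈ 𝒜.memberSubfamily v | #N = j} =
      #(bipartiteAbove (fun (v : α) (M : Finset α) => v ∈ M) {M ∈ 𝒜 | #M = j + 1} v) := by
    intro v _
    refine card_bij' (fun N _ => insert v N) (fun M _ => M.erase v) ?_ ?_ ?_ ?_
    · intro N hN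
      simp only [mem_filter, mem_memberSubfamily, bipartiteAbove] at hN ⊢
      exact ⟨⟨hN.1.1, by rw [card_insert_of_notMem hN.1.2, hN.2]⟩, mem_insert_self _ _⟩
    · intro M hM
      simp only [mem_filter, mem_memberSubfamily, bipartiteAbove] at hM ⊢
      exact ⟨⟨by rw [insert_erase hM.2]; exact hM.1.1, notMem_erase _ _⟩,
        by rw [card_erase_of_mem hM.2, hM.1.2]; rfl⟩
    · intro N hN
      simp only [mem_filter, mem_memberSubfamily] at hN
      exact erase_insert hN.1.2
    · intro M hM
      simp only [mem_filter, bipartiteAbove] at hM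
      exact insert_erase hM.2
  rw [sum_congr rfl h1, sum_card_bipartiteAbove_eq_sum_card_bipartiteBelow, mul_comm]
  refine sum_const_nat fun M hM => ?_
  rw [mem_filter] at hM
  rw [← hM.2, bipartiteBelow, filter_mem_eq_inter, inter_eq_right.2 (h𝒜 M hM.1)]

/-- Möbius inversion over the Boolean lattice. -/
theorem sum_powerset_neg_one_pow_mul_sum {ι : Type*} [DecidableEq ι] (R : Finset ι)
    (a : Finset ι → ℤ) :
    ∑ S ∈ R.powerset, (-1) ^ (#R - #S) * ∑ T ∈ S.powerset, a T = a R := by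
  induction R using Finset.induction_on generalizing a with
  | empty => simp
  | insert x R hx ih =>
    have hR : ∀ S ∈ R.powerset, x ∉ S := fun S hS h => hx (mem_powerset.1 hS h)
    rw [sum_powerset_insert hx]
    have h1 : ∀ S ∈ R.powerset, (-1 : ℤ) ^ (#(insert x R) - #S) * ∑ T ∈ S.powerset, a T =
        - ((-1) ^ (#R - #S) * ∑ T ∈ S.powerset, a T) := by
      intro S hS
      have := card_le_card (mem_powerset.1 hS)
      rw [card_insert_of_notMem hx, show #R + 1 - #S = (#R - #S) + 1 by omega, pow_succ]
      ring
    have h2 : ∀ S ∈ R.powerset,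
        (-1 : ℤ) ^ (#(insert x R) - #(insert x S)) * ∑ T ∈ (insert x S).powerset, a T =
        (-1) ^ (#R - #S) * ∑ T ∈ S.powerset, a T +
          (-1) ^ (#R - #S) * ∑ T ∈ S.powerset, a (insert x T) := by
      intro S hS
      rw [card_insert_of_notMem hx, card_insert_of_notMem (hR S hS), Nat.add_sub_add_right,
        sum_powerset_insert (hR S hS)]
      ring
    rw [sum_congr rfl h1, sum_congr rfl h2, sum_add_distrib, sum_neg_distrib,
      neg_add_cancel_left]
    exact ih fun T => a (insert x T)

end Counting

/-! ### Mixed faces as sets of maximizing vertices -/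

section CayleyFaces

/-- `W` is the vertex set of a polytope that lies in no affine hyperplane. -/
structure IsSpanningVertexSet {E : Type*} [AddCommGroup E] [Module ℝ E] [TopologicalSpace E]
    (W : Finset E) : Prop where
  nonempty : W.Nonempty
  extreme : (W : Set E) ⊆ (convexHull ℝ (W : Set E)).extremePoints ℝ
  exists_lt : ∀ l : StrongDual ℝ E, l ≠ 0 → ∃ x ∈ W, ∃ y ∈ W, l x < l y

theorem IsPolytope.isSpanningVertexSet {d : ℕ} {P : Set (EuclideanSpace ℝ (Fin d))}
    {W : Finset (EuclideanSpace ℝ (Fin d))} (h : IsPolytope d P W) :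
    IsSpanningVertexSet W := by
  have hdim := h.dim
  have hne : P ≠ ∅ := by
    rintro rfl
    simp only [polyDim, if_true] at hdim
    omega
  have hW : W.Nonempty := by
    rw [h.eq_hull] at hne
    simpa using convexHull_nonempty_iff.1 (Set.nonempty_iff_ne_empty.2 hne)
  refine ⟨hW, by rw [← h.eq_hull, h.vertices], fun l hl => ?_⟩
  rw [polyDim, if_neg hne, Nat.cast_inj, h.eq_hull, ← direction_affineSpan, affineSpan_convexHull,
    direction_affineSpan] at hdim
  have htop : vectorSpan ℝ (W : Set (EuclideanSpace ℝ (Fin d))) = ⊤ :=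
    Submodule.eq_top_of_finrank_eq (by simpa using hdim)
  by_contra! hle
  apply hl
  have hker : vectorSpan ℝ (W : Set (EuclideanSpace ℝ (Fin d))) ≤ LinearMap.ker l.toLinearMap := by
    rw [vectorSpan, Submodule.span_le]
    rintro _ ⟨x, hx, y, hy, rfl⟩
    have := le_antisymm (hle x hx y hy) (hle y hy x hx)
    simp [this]
  rw [htop, top_le_iff] at hker
  ext x
  have : x ∈ LinearMap.ker l.toLinearMap := hker ▸ Submodule.mem_top
  simpa using this

variable {r d : ℕ} {e : AffineBasis (Fin r) ℝ (EuclideanSpace ℝ (Fin (r - 1)))}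
  {V : Fin r → Finset (EuclideanSpace ℝ (Fin d))} {R S T : Finset (Fin r)}

theorem mk_mem_vertexSet {i : Fin r} {x : EuclideanSpace ℝ (Fin d)} :
    ((e i, x) : Space r d) ∈ vertexSet e V R ↔ i ∈ R ∧ x ∈ V i := by
  simp only [vertexSet, Finset.mem_biUnion, Finset.mem_image, Prod.mk.injEq]
  constructor
  · rintro ⟨j, hj, y, hy, hij, rfl⟩
    obtain rfl := e.ind.injective hij
    exact ⟨hj, hy⟩
  · rintro ⟨hi, hx⟩
    exact ⟨i, hi, x, hx, rfl, rfl⟩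

theorem exists_of_mem_vertexSet {p : Space r d} (hp : p ∈ vertexSet e V R) :
    ∃ i ∈ R, ∃ x ∈ V i, ((e i, x) : Space r d) = p := by
  simpa [vertexSet] using hp

theorem vertexSet_subset_vertexSet {W : Fin r → Finset (EuclideanSpace ℝ (Fin d))} (hST : S ⊆ T)
    (h : ∀ i ∈ S, W i ⊆ V i) : vertexSet e W S ⊆ vertexSet e V T := by
  intro p hp
  obtain ⟨i, hi, x, hx, rfl⟩ := exists_of_mem_vertexSet hp
  exact mk_mem_vertexSet.2 ⟨hST hi, h i hi hx⟩

variable (e) in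
/-- Affine functionals on the ambient space of the Cayley polytope are given by a functional `l` on
`ℝ^d` and an arbitrary constant for each of the summands. -/
theorem exists_dual_space (l : StrongDual ℝ (EuclideanSpace ℝ (Fin d))) (β : Fin r → ℝ) :
    ∃ (L : StrongDual ℝ (Space r d)) (c : ℝ), ∀ i x, L (e i, x) + c = l x + β i := by
  obtain ⟨a, c, h⟩ := exists_dual_eq_of_affineIndependent e.ind β
  refine ⟨a.coprod l, c, fun i x => ?_⟩
  rw [← h i, ContinuousLinearMap.coprod_apply]
  ring

theorem dual_space_apply (L : StrongDual ℝ (Space r d)) (a : EuclideanSpace ℝ (Fin (r - 1)))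
    (x : EuclideanSpace ℝ (Fin d)) :
    L (a, x) = L.comp (ContinuousLinearMap.inr ℝ _ _) x + L (a, 0) := by
  simp [← map_add]

variable (e V) in
/-- The vertices `(e_i, x)`, `i ∈ R`, for which `x` maximizes `l` over `V_i`. -/
noncomputable def maxVertices (l : StrongDual ℝ (EuclideanSpace ℝ (Fin d))) (R : Finset (Fin r)) :
    Finset (Space r d) :=
  vertexSet e (fun i => maximizers l (V i)) R

theorem mk_mem_maxVertices {l : StrongDual ℝ (EuclideanSpace ℝ (Fin d))} {i : Fin r}
    {x : EuclideanSpace ℝ (Fin d)} :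
    ((e i, x) : Space r d) ∈ maxVertices e V l R ↔ i ∈ R ∧ x ∈ maximizers l (V i) :=
  mk_mem_vertexSet

theorem maxVertices_subset_vertexSet (l : StrongDual ℝ (EuclideanSpace ℝ (Fin d))) (h : S ⊆ T) :
    maxVertices e V l S ⊆ vertexSet e V T :=
  vertexSet_subset_vertexSet h fun i _ => maximizers_subset l (V i)

theorem maxVertices_mono (l : StrongDual ℝ (EuclideanSpace ℝ (Fin d))) (h : S ⊆ T) :
    maxVertices e V l S ⊆ maxVertices e V l T :=
  vertexSet_subset_vertexSet h fun _ _ => Finset.Subset.rfl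

theorem finset_ext_vertexSet {M N : Finset (Space r d)} (hM : M ⊆ vertexSet e V S)
    (hN : N ⊆ vertexSet e V T) (h : ∀ i x, ((e i, x) : Space r d) ∈ M ↔ (e i, x) ∈ N) : M = N := by
  ext p
  constructor <;> intro hp
  · obtain ⟨i, -, x, -, rfl⟩ := exists_of_mem_vertexSet (hM hp)
    exact (h i x).1 hp
  · obtain ⟨i, -, x, -, rfl⟩ := exists_of_mem_vertexSet (hN hp)
    exact (h i x).2 hp

theorem maximizers_vertexSet_eq {l : StrongDual ℝ (EuclideanSpace ℝ (Fin d))}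
    {L : StrongDual ℝ (Space r d)} {β : Fin r → ℝ} {c : ℝ}
    (hL : ∀ i x, L (e i, x) + c = l x + β i) (hT : T.Nonempty) (hTR : T ⊆ R)
    (h1 : ∀ i ∈ T, ∃ y ∈ maximizers l (V i), l y + β i = 0)
    (h2 : ∀ i ∈ R, i ∉ T → ∀ y ∈ V i, l y + β i < 0) :
    maximizers L (vertexSet e V R) = maxVertices e V l T := by
  have hle : ∀ q ∈ vertexSet e V R, L q + c ≤ 0 := by
    intro q hq
    obtain ⟨i, hi, x, hx, rfl⟩ := exists_of_mem_vertexSet hq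
    rw [hL]
    by_cases hiT : i ∈ T
    · obtain ⟨y, hy, hy0⟩ := h1 i hiT
      linarith [(mem_maximizers.1 hy).2 x hx]
    · exact (h2 i hi hiT x hx).le
  refine finset_ext_vertexSet (maximizers_subset _ _)
    (maxVertices_subset_vertexSet l hTR) fun i x => ?_
  rw [mem_maximizers, mk_mem_maxVertices, mk_mem_vertexSet]
  constructor
  · rintro ⟨⟨hi, hx⟩, hmax⟩
    obtain ⟨j, hj⟩ := hT
    obtain ⟨z, hz, hz0⟩ := h1 j hj
    have h3 := hmax (e j, z) (mk_mem_vertexSet.2 ⟨hTR hj, (mem_maximizers.1 hz).1⟩)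
    have h4 := hL j z
    have h5 := hL i x
    have hiT : i ∈ T := by
      by_contra hiT
      linarith [h2 i hi hiT x hx]
    obtain ⟨y, hy, hy0⟩ := h1 i hiT
    exact ⟨hiT, mem_maximizers.2 ⟨hx, fun w hw => by linarith [(mem_maximizers.1 hy).2 w hw]⟩⟩
  · rintro ⟨hi, hx⟩
    refine ⟨⟨hTR hi, (mem_maximizers.1 hx).1⟩, fun q hq => ?_⟩
    obtain ⟨y, hy, hy0⟩ := h1 i hi
    linarith [hle q hq, hL i x, eq_of_mem_maximizers hx hy]

/-- The vertices maximizing `l` over the summands indexed by `T ⊆ R` span a face of `C_R`: the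
constants attached to the summands can be chosen so that the maxima for `i ∈ T` agree and exceed all
other values. -/
theorem isFace_maxVertices (hV : ∀ i, (V i).Nonempty) (hT : T.Nonempty) (hTR : T ⊆ R)
    (l : StrongDual ℝ (EuclideanSpace ℝ (Fin d))) :
    IsFace (cayleyPolytope e V R) (convexHull ℝ (maxVertices e V l T : Set (Space r d))) := by
  classical
  choose y hy using fun i => maximizers_nonempty l (hV i)
  obtain ⟨L, c, hL⟩ := exists_dual_space e l fun i => if i ∈ T then -l (y i) else -l (y i) - 1
  rw [← maximizers_vertexSet_eq hL hT hTR]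
  · exact isFace_convexHull_maximizers L _
  · intro i hi
    exact ⟨y i, hy i, by simp [hi]⟩
  · intro i _ hi x hx
    have := (mem_maximizers.1 (hy i)).2 x hx
    simp only [hi, if_false]
    linarith

/-- The points `(e_i, x)`, `x ∈ V_i`, span the face `{e_i} × P_i` (the case `l = 0`, `T = {i}` of
`isFace_maxVertices`), so that extreme points of `P_i` give extreme points of `C_R`. -/
theorem vertexSet_subset_extremePoints (hV : ∀ i, IsSpanningVertexSet (V i)) :
    (vertexSet e V R : Set (Space r d)) ⊆ (cayleyPolytope e V R).extremePoints ℝ := by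
  intro p hp
  obtain ⟨i, hi, x, hx, rfl⟩ := exists_of_mem_vertexSet hp
  have hface := isFace_maxVertices (e := e) (fun i => (hV i).nonempty)
    (Finset.singleton_nonempty i) (Finset.singleton_subset_iff.2 hi) 0
  refine (IsExposed.isExtreme hface).extremePoints_subset_extremePoints ?_
  have : (maxVertices e V 0 {i} : Set (Space r d)) = {e i} ×ˢ (V i : Set _) := by
    ext ⟨a, z⟩
    simp [maxVertices, vertexSet, mem_maximizers, eq_comm, and_comm]
  rw [this, convexHull_prod, convexHull_singleton, extremePoints_prod, extremePoints_singleton]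
  exact ⟨rfl, (hV i).extreme hx⟩

theorem mem_of_mem_convexHull (hV : ∀ i, IsSpanningVertexSet (V i)) {N : Finset (Space r d)}
    (hN : N ⊆ vertexSet e V R) {p : Space r d} (hp : p ∈ vertexSet e V R)
    (hpN : p ∈ convexHull ℝ (N : Set (Space r d))) : p ∈ N := by
  have hsub : convexHull ℝ (N : Set (Space r d)) ⊆ cayleyPolytope e V R :=
    convexHull_mono (by exact_mod_cast hN)
  exact extremePoints_convexHull_subset (inter_extremePoints_subset_extremePoints_of_subset hsub
    ⟨hpN, vertexSet_subset_extremePoints hV hp⟩)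

theorem convexHull_injOn (hV : ∀ i, IsSpanningVertexSet (V i)) :
    Set.InjOn (fun N : Finset (Space r d) => convexHull ℝ (N : Set (Space r d)))
      {N | N ⊆ vertexSet e V R} := by
  have key : ∀ M N : Finset (Space r d), M ⊆ vertexSet e V R → N ⊆ vertexSet e V R →
      convexHull ℝ (M : Set (Space r d)) = convexHull ℝ (N : Set (Space r d)) → M ⊆ N :=
    fun M N hM hN h p hp => mem_of_mem_convexHull hV hN (hM hp) (h ▸ subset_convexHull ℝ _ hp)
  exact fun M hM N hN h => (key M N hM hN h).antisymm (key N M hN hM h.symm)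

theorem convexHull_maxVertices_ne (hV : ∀ i, IsSpanningVertexSet (V i)) (hS : S.Nonempty)
    {l : StrongDual ℝ (EuclideanSpace ℝ (Fin d))} (hl : l ≠ 0) :
    convexHull ℝ (maxVertices e V l T : Set (Space r d)) ≠ cayleyPolytope e V S := by
  intro h
  obtain ⟨i, hi⟩ := hS
  obtain ⟨x, hx, y, hy, hxy⟩ := (hV i).exists_lt l hl
  have hx' : ((e i, x) : Space r d) ∈ convexHull ℝ (maxVertices e V l T : Set (Space r d)) := by
    rw [h]
    exact subset_convexHull ℝ _ (mk_mem_vertexSet.2 ⟨hi, hx⟩)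
  have hmem := mem_of_mem_convexHull hV (R := Finset.univ)
    (maxVertices_subset_vertexSet l (Finset.subset_univ T))
    (mk_mem_vertexSet.2 ⟨Finset.mem_univ i, hx⟩) hx'
  have := (mem_maximizers.1 (mk_mem_maxVertices.1 hmem).2).2 y hy
  linarith

/-- Even for a proper subset `T` of the index set, `M_T(l)` spans a face of the full Cayley polytope;
as `l` is not constant on any `V_i`, this face is none of the exceptional ones. -/
theorem affineIndependent_maxVertices (hV : ∀ i, IsSpanningVertexSet (V i))
    (hsimp : AsSimplicialAsPossible e V) {l : StrongDual ℝ (EuclideanSpace ℝ (Fin d))}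
    (hl : l ≠ 0) (hT : T.Nonempty) :
    AffineIndependent ℝ ((↑) : maxVertices e V l T → Space r d) := by
  obtain ⟨s, hs, hF⟩ := hsimp _
    (isFace_maxVertices (fun i => (hV i).nonempty) hT (Finset.subset_univ T) l)
    fun S hS => convexHull_maxVertices_ne hV hS hl
  have hsub := maxVertices_subset_vertexSet (e := e) (V := V) l (Finset.subset_univ T)
  have heq : maxVertices e V l T = s := by
    refine Finset.Subset.antisymm (fun p hp => ?_) fun p hp => ?_
    · refine extremePoints_convexHull_subset (𝕜 := ℝ) (A := (s : Set (Space r d))) ?_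
      rw [← hF]
      exact inter_extremePoints_subset_extremePoints_of_subset
        (convexHull_mono (by exact_mod_cast hsub))
        ⟨subset_convexHull ℝ _ hp, vertexSet_subset_extremePoints hV (hsub hp)⟩
    · have := subset_extremePoints_simplex hs hp
      rw [← hF] at this
      exact extremePoints_convexHull_subset this
  rw [heq]
  exact hs

/-- The mixed faces of `C_R` are spanned by the sets of vertices maximizing a nonzero functional. -/
theorem mem_mixedFaces_iff (hV : ∀ i, IsSpanningVertexSet (V i)) (hR : R.Nonempty)
    {F : Set (Space r d)} :
    F ∈ mixedFaces e V R ↔ ∃ l ≠ 0, F = convexHull ℝ (maxVertices e V l R : Set (Space r d)) := by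
  constructor
  · rintro ⟨hF, hne, hmixed⟩
    obtain ⟨i₀, hi₀⟩ := hR
    obtain ⟨x₀, -, hx₀⟩ := hmixed i₀ hi₀
    obtain ⟨L, hL⟩ := IsFace.exists_maximizers hF ⟨_, hx₀⟩
    have hmem : ∀ i ∈ R, ∃ x ∈ V i, ((e i, x) : Space r d) ∈ maximizers L (vertexSet e V R) := by
      intro i hi
      obtain ⟨x, hx, hxF⟩ := hmixed i hi
      exact ⟨x, hx, mem_of_mem_convexHull hV (maximizers_subset _ _)
        (mk_mem_vertexSet.2 ⟨hi, hx⟩) (hL ▸ hxF)⟩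
    obtain ⟨z₀, -, hz₀⟩ := hmem i₀ hi₀
    set l := L.comp (ContinuousLinearMap.inr ℝ (EuclideanSpace ℝ (Fin (r - 1)))
      (EuclideanSpace ℝ (Fin d))) with hl
    have hLl : ∀ i x, L (e i, x) + -L (e i₀, z₀) = l x + (L (e i, 0) - L (e i₀, z₀)) := by
      intro i x
      rw [dual_space_apply L (e i) x]
      ring
    have heq : maximizers L (vertexSet e V R) = maxVertices e V l R := by
      refine maximizers_vertexSet_eq hLl ⟨i₀, hi₀⟩ Finset.Subset.rfl (fun i hi => ?_)
        fun i hi hi' => absurd hi hi'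
      obtain ⟨x, hx, hxL⟩ := hmem i hi
      refine ⟨x, mem_maximizers.2 ⟨hx, fun y hy => ?_⟩, ?_⟩
      · have := (mem_maximizers.1 hxL).2 (e i, y) (mk_mem_vertexSet.2 ⟨hi, hy⟩)
        linarith [hLl i x, hLl i y]
      · rw [← hLl, eq_of_mem_maximizers hxL hz₀, add_neg_cancel]
    -- If `l = 0`, every vertex is a maximizer and the face is not proper.
    refine ⟨l, fun h0 => hne ?_, by rw [hL, heq]⟩
    rw [hL, heq, h0, cayleyPolytope]
    congr 2
    refine finset_ext_vertexSet (maxVertices_subset_vertexSet 0 Finset.Subset.rfl)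
      Finset.Subset.rfl fun i x => ?_
    simp [mk_mem_maxVertices, mk_mem_vertexSet, mem_maximizers]
  · rintro ⟨l, hl, rfl⟩
    refine ⟨isFace_maxVertices (fun i => (hV i).nonempty) hR Finset.Subset.rfl l,
      convexHull_maxVertices_ne hV hR hl, fun i hi => ?_⟩
    obtain ⟨x, hx⟩ := maximizers_nonempty l (hV i).nonempty
    exact ⟨x, (mem_maximizers.1 hx).1, subset_convexHull ℝ _ (mk_mem_maxVertices.2 ⟨hi, hx⟩)⟩

/-- Every set of vertices of a mixed face is itself the vertex set of a mixed face, for the set `T`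
of those summands that it meets: perturb `l` towards a functional exposing `N` as a face of the
simplex spanned by the maximizing vertices. -/
theorem exists_maxVertices_eq_of_subset (hV : ∀ i, IsSpanningVertexSet (V i))
    (hsimp : AsSimplicialAsPossible e V) {l : StrongDual ℝ (EuclideanSpace ℝ (Fin d))}
    (hl : l ≠ 0) {N : Finset (Space r d)} (hN : N.Nonempty) (hNM : N ⊆ maxVertices e V l R) :
    ∃ T ⊆ R, T.Nonempty ∧ ∃ l' : StrongDual ℝ (EuclideanSpace ℝ (Fin d)),
      l' ≠ 0 ∧ N = maxVertices e V l' T := by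
  classical
  have hR : R.Nonempty := by
    obtain ⟨p, hp⟩ := hN
    obtain ⟨i, hi, -⟩ := exists_of_mem_vertexSet (hNM hp)
    exact ⟨i, hi⟩
  obtain ⟨L, c, hL0, hL1, -⟩ :=
    exists_dual_maximizers_eq (affineIndependent_maxVertices hV hsimp hl hR) hNM hN
  set m := L.comp (ContinuousLinearMap.inr ℝ (EuclideanSpace ℝ (Fin (r - 1)))
    (EuclideanSpace ℝ (Fin d))) with hm
  have hev : ∀ i ∈ R, ∀ᶠ ε : ℝ in nhdsWithin 0 (Set.Ioi 0),
      maximizers (l + ε • m) (V i) = maximizers m (maximizers l (V i)) :=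
    fun i _ => eventually_maximizers_add_smul l m (V i)
  obtain ⟨ε, hε, hmax⟩ := ((eventually_add_smul_ne_zero hl m).and
    ((Filter.eventually_all_finset R).2 hev)).exists
  refine ⟨R.filter fun i => ∃ x, ((e i, x) : Space r d) ∈ N, Finset.filter_subset _ _, ?_,
    l + ε • m, hε, ?_⟩
  · obtain ⟨p, hp⟩ := hN
    obtain ⟨i, hi, x, -, rfl⟩ := exists_of_mem_vertexSet (hNM hp)
    exact ⟨i, Finset.mem_filter.2 ⟨hi, x, hp⟩⟩
  · refine finset_ext_vertexSet (hNM.trans (maxVertices_subset_vertexSet l Finset.Subset.rfl))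
      (maxVertices_subset_vertexSet (l + ε • m) (Finset.filter_subset _ _)) fun i x => ?_
    rw [mk_mem_maxVertices, Finset.mem_filter]
    have hval : ∀ y, L (e i, y) + c = m y + (L (e i, 0) + c) := fun y => by
      rw [dual_space_apply L (e i) y]; ring
    constructor
    · intro hx
      obtain ⟨hi, hxl⟩ := mk_mem_maxVertices.1 (hNM hx)
      refine ⟨⟨hi, x, hx⟩, ?_⟩
      rw [hmax i hi, mem_maximizers]
      refine ⟨hxl, fun y hy => ?_⟩
      have h1 := hL0 _ hx
      have h2 : L (e i, y) + c ≤ 0 := by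
        by_cases hyN : ((e i, y) : Space r d) ∈ N
        · exact (hL0 _ hyN).le
        · linarith [hL1 _ (mk_mem_maxVertices.2 ⟨hi, hy⟩) hyN]
      linarith [hval x, hval y]
    · rintro ⟨⟨hi, y, hy⟩, hx⟩
      rw [hmax i hi, mem_maximizers] at hx
      by_contra hxN
      have h1 := hL1 _ (mk_mem_maxVertices.2 ⟨hi, hx.1⟩) hxN
      have h2 := hL0 _ hy
      have h3 := hx.2 y (mk_mem_maxVertices.1 (hNM hy)).2
      linarith [hval x, hval y]

end CayleyFaces

/-! ### Dimension and purity of the mixed faces -/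

section Purity

variable {r d : ℕ} {e : AffineBasis (Fin r) ℝ (EuclideanSpace ℝ (Fin (r - 1)))}
  {V : Fin r → Finset (EuclideanSpace ℝ (Fin d))} {R S T : Finset (Fin r)}

theorem exists_larger_maximizers_of_pos {l m : StrongDual ℝ (EuclideanSpace ℝ (Fin d))}
    (hm : ∀ c : ℝ, m ≠ c • l) {y : Fin r → EuclideanSpace ℝ (Fin d)}
    (hy : ∀ i, y i ∈ maximizers l (V i))
    (hconst : ∀ i ∈ T, ∀ x ∈ maximizers l (V i), m x = m (y i))
    (hpos : ∃ i ∈ T, ∃ x ∈ V i, m (y i) < m x) :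
    ∃ l' : StrongDual ℝ (EuclideanSpace ℝ (Fin d)), l' ≠ 0 ∧
      (∀ i ∈ T, maximizers l (V i) ⊆ maximizers l' (V i)) ∧
      ∃ i ∈ T, ∃ x ∈ maximizers l' (V i), x ∉ maximizers l (V i) := by
  classical
  have hlt : ∀ i ∈ T, ∀ x ∈ V i, m (y i) < m x → l x < l (y i) := by
    intro i hi x hx hmx
    refine ((mem_maximizers.1 (hy i)).2 x hx).lt_of_ne fun h => ?_
    have : x ∈ maximizers l (V i) :=
      mem_maximizers.2 ⟨hx, fun z hz => h ▸ (mem_maximizers.1 (hy i)).2 z hz⟩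
    exact hmx.ne' (hconst i hi x this)
  -- The step length is the least one at which a further vertex becomes a maximizer.
  obtain ⟨⟨i₀, x₀⟩, hq₀, hmin⟩ := Finset.exists_min_image
    ((T.sigma V).filter fun q => m (y q.1) < m q.2)
    (fun q => (l (y q.1) - l q.2) / (m q.2 - m (y q.1))) <| by
      obtain ⟨i, hi, x, hx, h⟩ := hpos
      exact ⟨⟨i, x⟩, by simp [hi, hx, h]⟩
  simp only [Finset.mem_filter, Finset.mem_sigma] at hq₀ hmin
  obtain ⟨⟨hi₀, hx₀⟩, hmx₀⟩ := hq₀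
  set t := (l (y i₀) - l x₀) / (m x₀ - m (y i₀)) with ht
  have hlx₀ := hlt i₀ hi₀ x₀ hx₀ hmx₀
  have htpos : 0 < t := div_pos (by linarith) (by linarith)
  have hle : ∀ i ∈ T, ∀ x ∈ V i, l x + t * m x ≤ l (y i) + t * m (y i) := by
    intro i hi x hx
    rcases lt_or_ge (m (y i)) (m x) with h | h
    · have h1 := hmin ⟨i, x⟩ ⟨⟨hi, hx⟩, h⟩
      rw [le_div_iff₀ (by linarith)] at h1
      linarith
    · have h1 := (mem_maximizers.1 (hy i)).2 x hx
      have h2 := mul_le_mul_of_nonneg_left h htpos.le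
      linarith
  have heq : l x₀ + t * m x₀ = l (y i₀) + t * m (y i₀) := by
    have : t * (m x₀ - m (y i₀)) = l (y i₀) - l x₀ := div_mul_cancel₀ _ (by linarith)
    linarith
  refine ⟨l + t • m, fun h => ?_, fun i hi x hx => ?_, i₀, hi₀, x₀, ?_, fun h => ?_⟩
  · apply hm (-t⁻¹)
    ext z
    have h1 : l z + t * m z = 0 := by simpa using DFunLike.congr_fun h z
    have h2 : m z = t⁻¹ * (t * m z) := by rw [inv_mul_cancel_left₀ htpos.ne']
    rw [h2, show t * m z = - l z by linarith]
    simp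
  · refine mem_maximizers.2 ⟨(mem_maximizers.1 hx).1, fun z hz => ?_⟩
    simp only [add_apply, smul_apply, smul_eq_mul]
    rw [hconst i hi x hx, eq_of_mem_maximizers hx (hy i)]
    exact hle i hi z hz
  · refine mem_maximizers.2 ⟨hx₀, fun z hz => ?_⟩
    simp only [add_apply, smul_apply, smul_eq_mul]
    rw [heq]
    exact hle i₀ hi₀ z hz
  · exact hlx₀.ne (eq_of_mem_maximizers h (hy i₀))

/-- A functional `l` can be rotated in a direction `m` that is constant on all its faces until one
of these faces grows. -/
theorem exists_larger_maximizers (hV : ∀ i, IsSpanningVertexSet (V i)) (hT : T.Nonempty)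
    {l m : StrongDual ℝ (EuclideanSpace ℝ (Fin d))} (hm : ∀ c : ℝ, m ≠ c • l)
    (hconst : ∀ i ∈ T, ∀ x ∈ maximizers l (V i), ∀ y ∈ maximizers l (V i), m x = m y) :
    ∃ l' : StrongDual ℝ (EuclideanSpace ℝ (Fin d)), l' ≠ 0 ∧
      (∀ i ∈ T, maximizers l (V i) ⊆ maximizers l' (V i)) ∧
      ∃ i ∈ T, ∃ x ∈ maximizers l' (V i), x ∉ maximizers l (V i) := by
  choose y hy using fun i => maximizers_nonempty l (hV i).nonempty
  obtain ⟨i, hi⟩ := hT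
  obtain ⟨a, ha, b, hb, hab⟩ := (hV i).exists_lt m (by simpa using hm 0)
  rcases lt_or_ge (m (y i)) (m b) with h | h
  · exact exists_larger_maximizers_of_pos hm hy
      (fun j hj x hx => hconst j hj x hx _ (hy j)) ⟨i, hi, b, hb, h⟩
  · refine exists_larger_maximizers_of_pos (m := -m) (fun c hc => hm (-c) ?_) hy
      (fun j hj x hx => by simpa using hconst j hj x hx _ (hy j))
      ⟨i, hi, a, ha, by simpa using hab.trans_le h⟩
    ext z
    have := DFunLike.congr_fun hc z
    simp only [neg_apply, smul_apply, smul_eq_mul] at this ⊢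
    linarith

/-- The set `M` of vertices maximizing `l` has at most `d + |T| - 1` elements; if it has fewer, it
is properly contained in another such set. Restriction to `M` maps the `(d + |T|)`-dimensional space
of functionals on `ℝ^d` with a constant for each summand onto the space of functions on `M`, and its
kernel contains `l`; if the kernel contains more than the multiples of `l`, then `l` can be rotated
within it. -/
theorem card_maxVertices (hV : ∀ i, IsSpanningVertexSet (V i))
    (hsimp : AsSimplicialAsPossible e V) {l : StrongDual ℝ (EuclideanSpace ℝ (Fin d))}
    (hl : l ≠ 0) (hT : T.Nonempty) :
    (maxVertices e V l T).card + 1 = d + T.card ∨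
      ((maxVertices e V l T).card + 1 < d + T.card ∧
        ∃ l' : StrongDual ℝ (EuclideanSpace ℝ (Fin d)), l' ≠ 0 ∧
          maxVertices e V l T ⊂ maxVertices e V l' T) := by
  classical
  set M := maxVertices e V l T with hM
  choose y hy using fun i => maximizers_nonempty l (hV i).nonempty
  have hidx : ∀ p : M, ∃ i : T,
      e i = (p : Space r d).1 ∧ (p : Space r d).2 ∈ maximizers l (V i) := by
    rintro ⟨p, hp⟩
    obtain ⟨i, hi, x, hx, rfl⟩ := exists_of_mem_vertexSet hp
    exact ⟨⟨i, hi⟩, rfl, hx⟩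
  choose idx hidx1 hidx2 using hidx
  have hidx_mk : ∀ (i : T) x (h : ((e i, x) : Space r d) ∈ M), idx ⟨(e i, x), h⟩ = i :=
    fun i x h => Subtype.ext (e.ind.injective (hidx1 ⟨(e i, x), h⟩))
  let Φ : (Module.Dual ℝ (EuclideanSpace ℝ (Fin d)) × (T → ℝ)) →ₗ[ℝ] (M → ℝ) :=
    { toFun := fun q p => q.1 (p : Space r d).2 + q.2 (idx p)
      map_add' := fun q q' => by ext p; simp; ring
      map_smul' := fun c q => by ext p; simp; ring }
  have hΦ : ∀ q p, Φ q p = q.1 (p : Space r d).2 + q.2 (idx p) := fun _ _ => rfl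
  have hsurj : Function.Surjective Φ := by
    intro f
    obtain ⟨L, c, hL⟩ := exists_dual_eq_of_affineIndependent
      (affineIndependent_maxVertices hV hsimp hl hT) f
    refine ⟨((L.comp (ContinuousLinearMap.inr ℝ _ _)).toLinearMap,
      fun i => L (e i, 0) + c), funext fun p => ?_⟩
    have h1 := dual_space_apply L (p : Space r d).1 (p : Space r d).2
    rw [hΦ, ← hL p, show L p = L ((p : Space r d).1, (p : Space r d).2) from rfl, h1,
      ← hidx1 p, add_assoc]
    rfl
  have hrank : M.card + Module.finrank ℝ (LinearMap.ker Φ) = d + T.card := by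
    have h1 := LinearMap.finrank_range_add_finrank_ker Φ
    rw [LinearMap.range_eq_top.2 hsurj, finrank_top] at h1
    simpa [Subspace.dual_finrank_eq] using h1
  set q₀ : Module.Dual ℝ (EuclideanSpace ℝ (Fin d)) × (T → ℝ) :=
    (l.toLinearMap, fun i => - l (y i)) with hq₀
  have hq₀ker : q₀ ∈ LinearMap.ker Φ := by
    refine LinearMap.mem_ker.2 (funext fun p => ?_)
    have := eq_of_mem_maximizers (hidx2 p) (hy (idx p))
    simp [hΦ, hq₀, this]
  have hq₀ne : q₀ ≠ 0 := by
    intro h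
    refine hl (ContinuousLinearMap.ext fun z => ?_)
    simpa [hq₀] using LinearMap.congr_fun (congrArg Prod.fst h) z
  have hspan : Submodule.span ℝ {q₀} ≤ LinearMap.ker Φ := by
    simpa using hq₀ker
  have hone := finrank_span_singleton (K := ℝ) hq₀ne
  have hle := Submodule.finrank_mono hspan
  by_cases hcard : M.card + 1 = d + T.card
  · exact Or.inl hcard
  · refine Or.inr ⟨by omega, ?_⟩
    obtain ⟨⟨m, β⟩, hmker, hmspan⟩ : ∃ q ∈ LinearMap.ker Φ, q ∉ Submodule.span ℝ {q₀} := by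
      by_contra! h
      have := Submodule.finrank_mono (show LinearMap.ker Φ ≤ Submodule.span ℝ {q₀} from h)
      omega
    have hzero : ∀ q ∈ LinearMap.ker Φ, ∀ (i : T) (x) (_ : x ∈ maximizers l (V i)),
        q.1 x + q.2 i = 0 := by
      intro q hq i x hx
      have hmem : ((e i, x) : Space r d) ∈ M := mk_mem_maxVertices.2 ⟨i.2, hx⟩
      have := congrFun (LinearMap.mem_ker.1 hq) ⟨(e i, x), hmem⟩
      rwa [hΦ, hidx_mk i x hmem] at this
    have hne : ∀ c : ℝ, LinearMap.toContinuousLinearMap m ≠ c • l := by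
      intro c hc
      refine hmspan ?_
      refine Submodule.mem_span_singleton.2 ⟨c, ?_⟩
      have hmc : ∀ z, m z = c * l z := fun z => by
        simpa using DFunLike.congr_fun hc z
      refine Prod.ext (LinearMap.ext fun z => by simp [hq₀, hmc]) (funext fun i => ?_)
      have := hzero _ hmker i _ (hy i)
      simp only [hmc] at this
      simp only [hq₀, Prod.smul_mk, Pi.smul_apply, smul_eq_mul]
      linarith
    obtain ⟨l', hl', hsub, i, hi, x, hx, hxl⟩ := exists_larger_maximizers hV hT hne
      fun i hi x hx z hz => by
        have h1 := hzero _ hmker ⟨i, hi⟩ x hx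
        have h2 := hzero _ hmker ⟨i, hi⟩ z hz
        simp only [LinearMap.coe_toContinuousLinearMap']
        linarith
    refine ⟨l', hl', Finset.ssubset_iff_subset_ne.2 ⟨fun p hp => ?_, fun h => hxl ?_⟩⟩
    · obtain ⟨j, hj, z, hz, rfl⟩ := exists_of_mem_vertexSet hp
      exact mk_mem_maxVertices.2 ⟨hj, hsub j hj hz⟩
    · have : ((e i, x) : Space r d) ∈ M := h ▸ mk_mem_maxVertices.2 ⟨hi, hx⟩
      exact (mk_mem_maxVertices.1 this).2

/-- Every mixed face lies in one of dimension `d + |T| - 2`. -/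
theorem exists_maxVertices_card_eq (hV : ∀ i, IsSpanningVertexSet (V i))
    (hsimp : AsSimplicialAsPossible e V) (hT : T.Nonempty)
    {l : StrongDual ℝ (EuclideanSpace ℝ (Fin d))} (hl : l ≠ 0) :
    ∃ l' : StrongDual ℝ (EuclideanSpace ℝ (Fin d)), l' ≠ 0 ∧
      maxVertices e V l T ⊆ maxVertices e V l' T ∧
      (maxVertices e V l' T).card + 1 = d + T.card := by
  induction hn : d + T.card - (maxVertices e V l T).card using Nat.strong_induction_on
    generalizing l with
  | _ n ih =>
    rcases card_maxVertices hV hsimp hl hT with h | ⟨hlt, l', hl', hss⟩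
    · exact ⟨l, hl, Finset.Subset.rfl, h⟩
    · have := Finset.card_lt_card hss
      obtain ⟨l'', hl'', hsub, hcard⟩ := ih _ (by omega) hl' rfl
      exact ⟨l'', hl'', hss.subset.trans hsub, hcard⟩

end Purity

/-! ### Face numbers of the mixed faces, their complexes and links -/

section Families

variable {r d : ℕ} {e : AffineBasis (Fin r) ℝ (EuclideanSpace ℝ (Fin (r - 1)))}
  {V : Fin r → Finset (EuclideanSpace ℝ (Fin d))} {R S T : Finset (Fin r)}

/-- The convex hulls of the members of a family of finite sets. -/
def hulls {E : Type*} [AddCommGroup E] [Module ℝ E] (𝒜 : Finset (Finset E)) : Set (Set E) :=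
  (fun N : Finset E => convexHull ℝ (N : Set E)) '' 𝒜

/-- The number of members of size `k + 1` of a family of finite sets, that is, of `k`-dimensional
faces if the members are the vertex sets of simplices. -/
def sizeCount {E : Type*} (𝒜 : Finset (Finset E)) (k : ℤ) : ℤ :=
  (𝒜.filter fun N => (N.card : ℤ) = k + 1).card

/-- The link of `v` in a family of finite sets: the sets not containing `v` whose union with `{v}`
belongs to the family. -/
noncomputable def linkFamily {E : Type*} (v : E) (𝒜 : Finset (Finset E)) : Finset (Finset E) :=
  @Finset.memberSubfamily _ (Classical.decEq E) v 𝒜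

theorem mem_linkFamily {E : Type*} [inst : DecidableEq E] {v : E} {𝒜 : Finset (Finset E)}
    {N : Finset E} :
    N ∈ linkFamily v 𝒜 ↔ insert v N ∈ 𝒜 ∧ v ∉ N := by
  obtain rfl : inst = Classical.decEq E := Subsingleton.elim _ _
  exact @Finset.mem_memberSubfamily _ (Classical.decEq E) _ _ _

variable (e V R) in
/-- The vertex sets of the mixed faces of `C_R`. -/
noncomputable def mixedVertexSets : Finset (Finset (Space r d)) :=
  @Finset.filter _ (fun N => ∃ l : StrongDual ℝ (EuclideanSpace ℝ (Fin d)),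
    l ≠ 0 ∧ N = maxVertices e V l R) (Classical.decPred _) (vertexSet e V R).powerset

variable (e V R) in
/-- The vertex sets of the faces in the complex generated by the mixed faces of `C_R`. -/
noncomputable def complexVertexSets : Finset (Finset (Space r d)) :=
  @Finset.filter _ (fun N => ∃ M ∈ mixedVertexSets e V R, N ⊆ M) (Classical.decPred _)
    (vertexSet e V R).powerset

theorem mem_mixedVertexSets {N : Finset (Space r d)} : N ∈ mixedVertexSets e V R ↔
    ∃ l : StrongDual ℝ (EuclideanSpace ℝ (Fin d)), l ≠ 0 ∧ N = maxVertices e V l R := by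
  simp only [mixedVertexSets, Finset.mem_filter, Finset.mem_powerset, and_iff_right_iff_imp]
  rintro ⟨l, -, rfl⟩
  exact maxVertices_subset_vertexSet l Finset.Subset.rfl

theorem mem_complexVertexSets {N : Finset (Space r d)} : N ∈ complexVertexSets e V R ↔
    ∃ l : StrongDual ℝ (EuclideanSpace ℝ (Fin d)), l ≠ 0 ∧ N ⊆ maxVertices e V l R := by
  simp only [complexVertexSets, Finset.mem_filter, Finset.mem_powerset]
  constructor
  · rintro ⟨-, M, hM, hNM⟩
    obtain ⟨l, hl, rfl⟩ := mem_mixedVertexSets.1 hM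
    exact ⟨l, hl, hNM⟩
  · rintro ⟨l, hl, hN⟩
    exact ⟨hN.trans (maxVertices_subset_vertexSet l Finset.Subset.rfl), _,
      mem_mixedVertexSets.2 ⟨l, hl, rfl⟩, hN⟩

theorem mixedVertexSets_subset_complexVertexSets :
    mixedVertexSets e V R ⊆ complexVertexSets e V R := by
  intro N hN
  obtain ⟨l, hl, rfl⟩ := mem_mixedVertexSets.1 hN
  exact mem_complexVertexSets.2 ⟨l, hl, Finset.Subset.rfl⟩

theorem subset_vertexSet_of_mem {N : Finset (Space r d)} (hN : N ∈ complexVertexSets e V R) :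
    N ⊆ vertexSet e V R := by
  simp only [complexVertexSets, Finset.mem_filter, Finset.mem_powerset] at hN
  exact hN.1

theorem mem_complexVertexSets_of_subset {M N : Finset (Space r d)}
    (hM : M ∈ complexVertexSets e V R) (hNM : N ⊆ M) : N ∈ complexVertexSets e V R := by
  obtain ⟨l, hl, h⟩ := mem_complexVertexSets.1 hM
  exact mem_complexVertexSets.2 ⟨l, hl, hNM.trans h⟩

theorem affineIndependent_of_mem (hV : ∀ i, IsSpanningVertexSet (V i))
    (hsimp : AsSimplicialAsPossible e V) (hR : R.Nonempty) {N : Finset (Space r d)}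
    (hN : N ∈ complexVertexSets e V R) : AffineIndependent ℝ ((↑) : N → Space r d) := by
  obtain ⟨l, hl, hsub⟩ := mem_complexVertexSets.1 hN
  exact (affineIndependent_maxVertices hV hsimp hl hR).mono (by exact_mod_cast hsub)

theorem mixedFaces_eq_hulls (hV : ∀ i, IsSpanningVertexSet (V i)) (hR : R.Nonempty) :
    mixedFaces e V R = hulls (mixedVertexSets e V R) := by
  ext F
  rw [mem_mixedFaces_iff hV hR]
  constructor
  · rintro ⟨l, hl, rfl⟩
    exact ⟨_, mem_mixedVertexSets.2 ⟨l, hl, rfl⟩, rfl⟩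
  · rintro ⟨N, hN, rfl⟩
    obtain ⟨l, hl, rfl⟩ := mem_mixedVertexSets.1 hN
    exact ⟨l, hl, rfl⟩

theorem mixedComplex_eq_hulls (hV : ∀ i, IsSpanningVertexSet (V i))
    (hsimp : AsSimplicialAsPossible e V) (hR : R.Nonempty) :
    mixedComplex e V R = hulls (complexVertexSets e V R) := by
  ext G
  constructor
  · rintro ⟨F, hF, hG⟩
    obtain ⟨l, hl, rfl⟩ := (mem_mixedFaces_iff hV hR).1 hF
    obtain ⟨N, hN, rfl⟩ :=
      (isFace_simplex_iff (affineIndependent_maxVertices hV hsimp hl hR)).1 hG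
    exact ⟨N, mem_complexVertexSets.2 ⟨l, hl, hN⟩, rfl⟩
  · rintro ⟨N, hN, rfl⟩
    obtain ⟨l, hl, hsub⟩ := mem_complexVertexSets.1 hN
    exact ⟨_, (mem_mixedFaces_iff hV hR).2 ⟨l, hl, rfl⟩,
      (isFace_simplex_iff (affineIndependent_maxVertices hV hsimp hl hR)).2 ⟨N, hsub, rfl⟩⟩

theorem link_mixedComplex_eq_hulls (hV : ∀ i, IsSpanningVertexSet (V i))
    (hsimp : AsSimplicialAsPossible e V) (hR : R.Nonempty) {v : Space r d}
    (hv : v ∈ vertexSet e V R) :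
    link (mixedComplex e V R) v = hulls (linkFamily v (complexVertexSets e V R)) := by
  classical
  rw [mixedComplex_eq_hulls hV hsimp hR]
  ext G
  constructor
  · rintro ⟨hvG, F, ⟨M, hM, rfl⟩, hvF, hG⟩
    obtain ⟨N, hN, rfl⟩ := (isFace_simplex_iff (affineIndependent_of_mem hV hsimp hR hM)).1 hG
    have hvM := mem_of_mem_convexHull hV (subset_vertexSet_of_mem hM) hv hvF
    refine ⟨N, ?_, rfl⟩
    rw [Finset.mem_coe, mem_linkFamily]
    exact ⟨mem_complexVertexSets_of_subset hM (Finset.insert_subset hvM hN),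
      fun h => hvG (subset_convexHull ℝ _ h)⟩
  · rintro ⟨N, hN, rfl⟩
    rw [Finset.mem_coe, mem_linkFamily] at hN
    have hsub := Finset.subset_insert v N
    refine ⟨fun h => hN.2 (mem_of_mem_convexHull hV
        (hsub.trans (subset_vertexSet_of_mem hN.1)) hv h), _, ⟨_, hN.1, rfl⟩,
      subset_convexHull ℝ _ (by simp), ?_⟩
    exact (isFace_simplex_iff (affineIndependent_of_mem hV hsimp hR hN.1)).2 ⟨N, hsub, rfl⟩

theorem mixedLink_eq_hulls (hV : ∀ i, IsSpanningVertexSet (V i))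
    (hsimp : AsSimplicialAsPossible e V) (hR : R.Nonempty) {v : Space r d}
    (hv : v ∈ vertexSet e V R) :
    mixedLink e V R v = hulls (linkFamily v (mixedVertexSets e V R)) := by
  classical
  rw [mixedLink, link_mixedComplex_eq_hulls hV hsimp hR hv, mixedFaces_eq_hulls hV hR]
  have hins : ∀ N : Finset (Space r d), convexHull ℝ (insert v (convexHull ℝ (N : Set (Space r d))))
      = convexHull ℝ (insert v N : Finset (Space r d)) := by
    intro N
    rw [Finset.coe_insert, Set.insert_eq, Set.insert_eq, convexHull_convexHull_union_right]
  ext G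
  constructor
  · rintro ⟨⟨N, hN, rfl⟩, M, hM, hMN⟩
    rw [Finset.mem_coe, mem_linkFamily] at hN
    simp only [hins] at hMN
    have := convexHull_injOn hV
      (subset_vertexSet_of_mem (mixedVertexSets_subset_complexVertexSets hM))
      (subset_vertexSet_of_mem hN.1) hMN
    refine ⟨N, ?_, rfl⟩
    rw [Finset.mem_coe, mem_linkFamily]
    exact ⟨this ▸ hM, hN.2⟩
  · rintro ⟨N, hN, rfl⟩
    rw [Finset.mem_coe, mem_linkFamily] at hN
    refine ⟨⟨N, ?_, rfl⟩, insert v N, hN.1, (hins N).symm⟩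
    rw [Finset.mem_coe, mem_linkFamily]
    exact ⟨mixedVertexSets_subset_complexVertexSets hN.1, hN.2⟩

theorem polyDim_convexHull_of_mem (hV : ∀ i, IsSpanningVertexSet (V i))
    (hsimp : AsSimplicialAsPossible e V) (hR : R.Nonempty) {N : Finset (Space r d)}
    (hN : N ∈ complexVertexSets e V R) :
    polyDim (convexHull ℝ (N : Set (Space r d))) = N.card - 1 :=
  polyDim_simplex (affineIndependent_of_mem hV hsimp hR hN)

theorem numFaces_hulls (hV : ∀ i, IsSpanningVertexSet (V i))
    (hsimp : AsSimplicialAsPossible e V) (hR : R.Nonempty) {𝒜 : Finset (Finset (Space r d))}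
    (h𝒜 : 𝒜 ⊆ complexVertexSets e V R) : numFaces (hulls 𝒜) = sizeCount 𝒜 := by
  funext k
  have : {F ∈ hulls 𝒜 | polyDim F = k} = (fun N : Finset (Space r d) =>
      convexHull ℝ (N : Set (Space r d))) '' (𝒜.filter fun N => (N.card : ℤ) = k + 1) := by
    ext F
    constructor
    · rintro ⟨⟨N, hN, rfl⟩, hk⟩
      have := polyDim_convexHull_of_mem hV hsimp hR (h𝒜 hN)
      refine ⟨N, ?_, rfl⟩
      simp only [Finset.coe_filter, Set.mem_ofPred_eq]
      exact ⟨hN, by linarith⟩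
    · rintro ⟨N, hN, rfl⟩
      simp only [Finset.coe_filter, Set.mem_ofPred_eq] at hN
      have := polyDim_convexHull_of_mem hV hsimp hR (h𝒜 hN.1)
      exact ⟨⟨N, hN.1, rfl⟩, by linarith⟩
  rw [numFaces, sizeCount, this, Set.InjOn.ncard_image, Set.ncard_coe_finset]
  exact (convexHull_injOn hV).mono fun N hN =>
    subset_vertexSet_of_mem (h𝒜 (Finset.mem_filter.1 hN).1)

theorem facesDim_hulls (hV : ∀ i, IsSpanningVertexSet (V i))
    (hsimp : AsSimplicialAsPossible e V) (hR : R.Nonempty) {𝒜 : Finset (Finset (Space r d))}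
    (h𝒜 : 𝒜 ⊆ complexVertexSets e V R) {n : ℕ} (hle : ∀ N ∈ 𝒜, N.card ≤ n)
    (hn : ∃ N ∈ 𝒜, N.card = n) : (facesDim (hulls 𝒜) + 1).toNat = n := by
  have : IsGreatest (polyDim '' hulls 𝒜) ((n : ℤ) - 1) := by
    constructor
    · obtain ⟨N, hN, rfl⟩ := hn
      exact ⟨_, ⟨N, hN, rfl⟩, polyDim_convexHull_of_mem hV hsimp hR (h𝒜 hN)⟩
    · rintro _ ⟨_, ⟨N, hN, rfl⟩, rfl⟩
      have h1 := polyDim_convexHull_of_mem hV hsimp hR (h𝒜 hN)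
      have h2 := hle N hN
      simp only [h1]
      omega
  rw [facesDim, this.csSup_eq]
  omega

theorem sizeCount_empty {E : Type*} : sizeCount (∅ : Finset (Finset E)) = fun _ => 0 := by
  funext k
  simp [sizeCount]

/-- For an empty family the value of `facesDim` is irrelevant, as all `h`-numbers vanish. -/
theorem hFaces_hulls (hV : ∀ i, IsSpanningVertexSet (V i))
    (hsimp : AsSimplicialAsPossible e V) (hR : R.Nonempty) {𝒜 : Finset (Finset (Space r d))}
    (h𝒜 : 𝒜 ⊆ complexVertexSets e V R) {n : ℕ} (hle : ∀ N ∈ 𝒜, N.card ≤ n)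
    (hn : 𝒜.Nonempty → ∃ N ∈ 𝒜, N.card = n) :
    hFaces (hulls 𝒜) = hNum n (sizeCount 𝒜) ∧ hFacesGen (hulls 𝒜) = hGen n (sizeCount 𝒜) := by
  have hnum := numFaces_hulls hV hsimp hR h𝒜
  rcases 𝒜.eq_empty_or_nonempty with rfl | hne
  · constructor
    · funext k
      rw [hFaces, hnum, sizeCount_empty, hNum_zero, hNum_zero]
    · simp only [hFacesGen, hnum, sizeCount_empty, hGen, hNum_zero, map_zero, zero_mul,
        Finset.sum_const_zero]
  · have hdim := facesDim_hulls hV hsimp hR h𝒜 hle (hn hne)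
    constructor
    · funext k
      rw [hFaces, hdim, hnum]
    · rw [hFacesGen, hdim, hnum]

theorem card_le_of_mem (hV : ∀ i, IsSpanningVertexSet (V i))
    (hsimp : AsSimplicialAsPossible e V) (hR : R.Nonempty) {N : Finset (Space r d)}
    (hN : N ∈ complexVertexSets e V R) : N.card + 1 ≤ d + R.card := by
  obtain ⟨l, hl, hsub⟩ := mem_complexVertexSets.1 hN
  have := Finset.card_le_card hsub
  rcases card_maxVertices hV hsimp hl hR with h | ⟨h, -⟩ <;> omega

theorem exists_superset_card_eq (hV : ∀ i, IsSpanningVertexSet (V i))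
    (hsimp : AsSimplicialAsPossible e V) (hR : R.Nonempty) {N : Finset (Space r d)}
    (hN : N ∈ complexVertexSets e V R) :
    ∃ M ∈ mixedVertexSets e V R, N ⊆ M ∧ M.card + 1 = d + R.card := by
  obtain ⟨l, hl, hsub⟩ := mem_complexVertexSets.1 hN
  obtain ⟨l', hl', hsub', hcard⟩ := exists_maxVertices_card_eq hV hsimp hR hl
  exact ⟨_, mem_mixedVertexSets.2 ⟨l', hl', rfl⟩, hsub.trans hsub', hcard⟩

theorem card_le_of_mem_linkFamily (hV : ∀ i, IsSpanningVertexSet (V i))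
    (hsimp : AsSimplicialAsPossible e V) (hR : R.Nonempty) {v : Space r d} {N : Finset (Space r d)}
    (hN : N ∈ linkFamily v (complexVertexSets e V R)) : N.card ≤ d + R.card - 2 := by
  classical
  rw [mem_linkFamily] at hN
  have := card_le_of_mem hV hsimp hR hN.1
  rw [Finset.card_insert_of_notMem hN.2] at this
  omega

/-- The links of `v` in `F_R` and in `K_R` are empty or of dimension `d + |R| - 3`, because a face
containing `v` lies in a mixed face of dimension `d + |R| - 2`. -/
theorem hFaces_hulls_linkFamily (hV : ∀ i, IsSpanningVertexSet (V i))
    (hsimp : AsSimplicialAsPossible e V) (hR : R.Nonempty) {𝒜 : Finset (Finset (Space r d))}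
    (h1 : mixedVertexSets e V R ⊆ 𝒜) (h2 : 𝒜 ⊆ complexVertexSets e V R) (v : Space r d) :
    hFaces (hulls (linkFamily v 𝒜)) = hNum (d + R.card - 2) (sizeCount (linkFamily v 𝒜)) ∧
    hFacesGen (hulls (linkFamily v 𝒜)) =
      hGen (d + R.card - 2) (sizeCount (linkFamily v 𝒜)) := by
  classical
  have hsub : linkFamily v 𝒜 ⊆ linkFamily v (complexVertexSets e V R) := by
    intro N hN
    rw [mem_linkFamily] at hN ⊢
    exact ⟨h2 hN.1, hN.2⟩
  refine hFaces_hulls hV hsimp hR ?_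
    (fun N hN => card_le_of_mem_linkFamily hV hsimp hR (hsub hN)) ?_
  · intro N hN
    rw [mem_linkFamily] at hN
    exact mem_complexVertexSets_of_subset (h2 hN.1) (Finset.subset_insert v N)
  · rintro ⟨N, hN⟩
    rw [mem_linkFamily] at hN
    obtain ⟨M, hM, hNM, hcard⟩ := exists_superset_card_eq hV hsimp hR (h2 hN.1)
    have hvM : v ∈ M := hNM (Finset.mem_insert_self v N)
    refine ⟨M.erase v, ?_, ?_⟩
    · rw [mem_linkFamily, Finset.insert_erase hvM]
      exact ⟨h1 hM, Finset.notMem_erase v M⟩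
    · rw [Finset.card_erase_of_mem hvM]
      omega

theorem sizeCount_natCast {E : Type*} (𝒜 : Finset (Finset E)) (j : ℕ) :
    sizeCount 𝒜 j = (𝒜.filter fun N => N.card = j + 1).card := by
  simp only [sizeCount, Nat.cast_inj]
  norm_cast

theorem sum_sizeCount_linkFamily {E : Type*} {W : Finset E} {𝒜 : Finset (Finset E)}
    (h𝒜 : ∀ M ∈ 𝒜, M ⊆ W) (j : ℕ) :
    ∑ v ∈ W, sizeCount (linkFamily v 𝒜) ((j : ℤ) - 1) = ((j : ℤ) + 1) * sizeCount 𝒜 j := by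
  have := @sum_card_memberSubfamily _ (Classical.decEq E) _ _ h𝒜 j
  rw [sizeCount_natCast]
  simp only [sizeCount, sub_add_cancel, Nat.cast_inj]
  exact_mod_cast this

/-- A nonempty vertex set of a face of the complex `K_R` is the vertex set of a mixed face of `C_T`
for a unique `T ⊆ R`. -/
theorem sizeCount_complexVertexSets (hV : ∀ i, IsSpanningVertexSet (V i))
    (hsimp : AsSimplicialAsPossible e V) (j : ℕ) :
    sizeCount (complexVertexSets e V R) j =
      ∑ T ∈ R.powerset, sizeCount (mixedVertexSets e V T) j := by
  classical
  have hunion : (complexVertexSets e V R).filter (fun N => N.card = j + 1) =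
      R.powerset.biUnion fun T => (mixedVertexSets e V T).filter fun N => N.card = j + 1 := by
    ext N
    simp only [Finset.mem_filter, Finset.mem_biUnion, Finset.mem_powerset]
    constructor
    · rintro ⟨hN, hcard⟩
      obtain ⟨l, hl, hsub⟩ := mem_complexVertexSets.1 hN
      obtain ⟨T, hTR, -, l', hl', hNl'⟩ := exists_maxVertices_eq_of_subset hV hsimp hl
        (Finset.card_pos.1 (by omega)) hsub
      exact ⟨T, hTR, mem_mixedVertexSets.2 ⟨l', hl', hNl'⟩, hcard⟩
    · rintro ⟨T, hTR, hN, hcard⟩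
      obtain ⟨l, hl, rfl⟩ := mem_mixedVertexSets.1 hN
      exact ⟨mem_complexVertexSets.2 ⟨l, hl, maxVertices_mono l hTR⟩, hcard⟩
  have htypes : ∀ S T : Finset (Fin r), ∀ N, N ∈ mixedVertexSets e V S →
      N ∈ mixedVertexSets e V T → S ⊆ T := by
    intro S T N hS hT i hi
    obtain ⟨l, -, rfl⟩ := mem_mixedVertexSets.1 hS
    obtain ⟨l', -, h⟩ := mem_mixedVertexSets.1 hT
    obtain ⟨x, hx⟩ := maximizers_nonempty l (hV i).nonempty
    have := (mk_mem_maxVertices (e := e)).2 ⟨hi, hx⟩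
    rw [h] at this
    exact (mk_mem_maxVertices.1 this).1
  simp only [sizeCount_natCast]
  rw [hunion, Finset.card_biUnion, Nat.cast_sum]
  intro S _ T _ hST
  refine Finset.disjoint_left.2 fun N hN hN' => hST ?_
  rw [Finset.mem_filter] at hN hN'
  exact (htypes S T N hN.1 hN'.1).antisymm (htypes T S N hN'.1 hN.1)

theorem sizeCount_mixedVertexSets (hV : ∀ i, IsSpanningVertexSet (V i))
    (hsimp : AsSimplicialAsPossible e V) (j : ℕ) :
    ∑ S ∈ R.powerset with S.Nonempty,
      (-1) ^ (R.card - S.card) * sizeCount (complexVertexSets e V S) j =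
        sizeCount (mixedVertexSets e V R) j := by
  classical
  rw [Finset.sum_filter_of_ne]
  · simp only [sizeCount_complexVertexSets hV hsimp]
    exact sum_powerset_neg_one_pow_mul_sum R fun T => sizeCount (mixedVertexSets e V T) j
  -- The term of `S = ∅` vanishes: the only member of the family is the empty set.
  · intro S _ hne
    by_contra hS
    rw [Finset.not_nonempty_iff_eq_empty] at hS
    subst hS
    refine hne ?_
    rw [sizeCount_natCast, Finset.filter_eq_empty_iff.2]
    · simp
    · intro N hN
      have := subset_vertexSet_of_mem hN
      simp [vertexSet] at this
      simp [this]

theorem facesDim_mixedFaces (hd : 1 ≤ d) (hV : ∀ i, IsSpanningVertexSet (V i))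
    (hsimp : AsSimplicialAsPossible e V) (hR : R.Nonempty) :
    (facesDim (mixedFaces e V R) + 1).toNat = d + R.card - 2 + 1 := by
  rw [mixedFaces_eq_hulls hV hR]
  have hpos := hR.card_pos
  refine facesDim_hulls hV hsimp hR mixedVertexSets_subset_complexVertexSets (fun N hN => ?_) ?_
  · have := card_le_of_mem hV hsimp hR (mixedVertexSets_subset_complexVertexSets hN)
    omega
  · let l : StrongDual ℝ (EuclideanSpace ℝ (Fin d)) := EuclideanSpace.proj ⟨0, hd⟩
    have hl : l ≠ 0 := by
      intro h
      simpa [l] using DFunLike.congr_fun h (EuclideanSpace.single ⟨0, hd⟩ 1)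
    obtain ⟨M, hM, -, hcard⟩ := exists_superset_card_eq hV hsimp hR
      (mem_complexVertexSets.2 ⟨l, hl, Finset.Subset.rfl⟩)
    exact ⟨M, hM, by omega⟩

/-- The number of pairs consisting of a mixed face of `C_R` of dimension `k + 1` and one of its
vertices. -/
noncomputable def incidenceCount (e : AffineBasis (Fin r) ℝ (EuclideanSpace ℝ (Fin (r - 1))))
    (V : Fin r → Finset (EuclideanSpace ℝ (Fin d))) (R : Finset (Fin r)) (k : ℤ) : ℤ :=
  ∑ v ∈ vertexSet e V R, sizeCount (linkFamily v (mixedVertexSets e V R)) k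

theorem incidenceCount_sub_one (j : ℕ) :
    incidenceCount e V R ((j : ℤ) - 1) = ((j : ℤ) + 1) * sizeCount (mixedVertexSets e V R) j :=
  sum_sizeCount_linkFamily (fun _ hM =>
    subset_vertexSet_of_mem (mixedVertexSets_subset_complexVertexSets hM)) j

theorem incidenceCount_eq_fMixed (hV : ∀ i, IsSpanningVertexSet (V i))
    (hsimp : AsSimplicialAsPossible e V) (hR : R.Nonempty) (j : ℕ) :
    incidenceCount e V R ((j : ℤ) - 1) = ((j : ℤ) + 1) * fMixed e V R j := by
  rw [incidenceCount_sub_one, fMixed, if_neg (by omega), mixedFaces_eq_hulls hV hR,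
    numFaces_hulls hV hsimp hR mixedVertexSets_subset_complexVertexSets]

theorem sum_hFacesGen_mixedLink (hV : ∀ i, IsSpanningVertexSet (V i))
    (hsimp : AsSimplicialAsPossible e V) (hR : R.Nonempty) :
    ∑ v ∈ vertexSet e V R, hFacesGen (mixedLink e V R v) =
      hGen (d + R.card - 2) (incidenceCount e V R) := by
  refine Eq.trans (Finset.sum_congr rfl fun v hv => ?_) (hGen_sum _ _ _).symm
  rw [mixedLink_eq_hulls hV hsimp hR hv]
  exact (hFaces_hulls_linkFamily hV hsimp hR Finset.Subset.rfl
    mixedVertexSets_subset_complexVertexSets v).2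

theorem sum_hFaces_mixedLink (hV : ∀ i, IsSpanningVertexSet (V i))
    (hsimp : AsSimplicialAsPossible e V) (hR : R.Nonempty) (k : ℕ) :
    ∑ v ∈ vertexSet e V R, hFaces (mixedLink e V R v) k =
      hNum (d + R.card - 2) (incidenceCount e V R) k := by
  refine Eq.trans (Finset.sum_congr rfl fun v hv => ?_) (hNum_sum _ _ _ _).symm
  rw [mixedLink_eq_hulls hV hsimp hR hv]
  exact congrFun (hFaces_hulls_linkFamily hV hsimp hR Finset.Subset.rfl
    mixedVertexSets_subset_complexVertexSets v).1 k

/-- The `g`-vector of order `|R| - |S|` of a link in `K_S` consists of the `h`-numbers computed for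
the dimension of the links in `K_R`. -/
theorem gFaces_link_mixedComplex (hd : 1 ≤ d) (hV : ∀ i, IsSpanningVertexSet (V i))
    (hsimp : AsSimplicialAsPossible e V) (hS : S.Nonempty) (hSR : S ⊆ R) {v : Space r d}
    (hv : v ∈ vertexSet e V S) (k : ℕ) :
    gFaces (link (mixedComplex e V S) v) (R.card - S.card) k =
      hNum (d + R.card - 2) (sizeCount (linkFamily v (complexVertexSets e V S))) k := by
  have hcard := Finset.card_le_card hSR
  have hSpos := hS.card_pos
  have hh := (hFaces_hulls_linkFamily hV hsimp hS mixedVertexSets_subset_complexVertexSets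
    Finset.Subset.rfl v).1
  rw [gFaces, link_mixedComplex_eq_hulls hV hsimp hS hv, hh, backDiff_hNum,
    show d + S.card - 2 + (R.card - S.card) = d + R.card - 2 by omega]
  intro j hj
  rw [sizeCount_natCast, Finset.filter_eq_empty_iff.2]
  · simp
  · intro N hN
    have := card_le_of_mem_linkFamily hV hsimp hS hN
    omega

/-- The incidence numbers of the mixed faces are the alternating sums of those of the complexes
`K_S`; passing from `K_S` to the larger dimension of `K_R` accounts for the `g`-vectors. -/
theorem sum_gFaces_link (hd : 1 ≤ d) (hV : ∀ i, IsSpanningVertexSet (V i))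
    (hsimp : AsSimplicialAsPossible e V) (k : ℕ) :
    ∑ S ∈ R.powerset with S.Nonempty, (-1) ^ (R.card - S.card) *
        ∑ v ∈ vertexSet e V S, gFaces (link (mixedComplex e V S) v) (R.card - S.card) k =
      hNum (d + R.card - 2) (incidenceCount e V R) k := by
  have hsum : ∀ S ∈ R.powerset.filter Finset.Nonempty,
      (-1 : ℤ) ^ (R.card - S.card) * ∑ v ∈ vertexSet e V S,
        gFaces (link (mixedComplex e V S) v) (R.card - S.card) k =
      (-1) ^ (R.card - S.card) * hNum (d + R.card - 2) (fun j => ∑ v ∈ vertexSet e V S,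
        sizeCount (linkFamily v (complexVertexSets e V S)) j) k := by
    intro S hS
    rw [Finset.mem_filter, Finset.mem_powerset] at hS
    rw [hNum_sum]
    congr 1
    exact Finset.sum_congr rfl fun v hv =>
      gFaces_link_mixedComplex hd hV hsimp hS.2 hS.1 hv k
  rw [Finset.sum_congr rfl hsum, ← hNum_sum_mul]
  refine congrFun (hNum_congr fun j _ => ?_) k
  rw [incidenceCount_sub_one, ← sizeCount_mixedVertexSets hV hsimp, Finset.mul_sum]
  refine Finset.sum_congr rfl fun S _ => ?_
  rw [sum_sizeCount_linkFamily fun M hM => subset_vertexSet_of_mem hM]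
  ring

end Families

end Cayley

theorem mainTheorem5 (r d : ℕ) (hd : 1 ≤ d)
    (e : AffineBasis (Fin r) ℝ (EuclideanSpace ℝ (Fin (r - 1))))
    (P : Fin r → Set (EuclideanSpace ℝ (Fin d)))
    (V : Fin r → Finset (EuclideanSpace ℝ (Fin d)))
    (hP : ∀ i, Cayley.IsPolytope d (P i) (V i))
    (hsimp : Cayley.AsSimplicialAsPossible e V)
    (R : Finset (Fin r)) (hR : R.Nonempty) :
    (Polynomial.C ((d : ℤ) + R.card - 1) * Cayley.hMixedGen e V R
        + (1 - Polynomial.X) * Polynomial.derivative (Cayley.hMixedGen e V R)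
      = ∑ v ∈ Cayley.vertexSet e V R, Cayley.hFacesGen (Cayley.mixedLink e V R v)) ∧
    (∀ k : ℕ, (k : ℤ) ≤ (d : ℤ) + R.card - 2 →
      ((k : ℤ) + 1) * Cayley.hMixed e V R (k + 1)
          + ((d : ℤ) + R.card - 1 - k) * Cayley.hMixed e V R k
        = ∑ v ∈ Cayley.vertexSet e V R, Cayley.hFaces (Cayley.mixedLink e V R v) k) ∧
    (∀ k : ℕ, (k : ℤ) ≤ (d : ℤ) + R.card - 2 →
      ((k : ℤ) + 1) * Cayley.hMixed e V R (k + 1)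
          + ((d : ℤ) + R.card - 1 - k) * Cayley.hMixed e V R k
        = ∑ S ∈ R.powerset with S.Nonempty, (-1) ^ (R.card - S.card)
            * ∑ v ∈ Cayley.vertexSet e V S,
                Cayley.gFaces (Cayley.link (Cayley.mixedComplex e V S) v)
                  (R.card - S.card) k) := by
  have hV : ∀ i, Cayley.IsSpanningVertexSet (V i) := fun i => (hP i).isSpanningVertexSet
  have hpos := hR.card_pos
  have hδ : (d : ℤ) + R.card - 1 = ((d + R.card - 2 : ℕ) : ℤ) + 1 := by omega
  have hinc : ∀ j : ℕ, j ≤ d + R.card - 2 → Cayley.incidenceCount e V R ((j : ℤ) - 1) =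
      ((j : ℤ) + 1) * Cayley.fMixed e V R j :=
    fun j _ => Cayley.incidenceCount_eq_fMixed hV hsimp hR j
  have hlhs : ∀ k : ℕ, (k : ℤ) ≤ (d : ℤ) + R.card - 2 →
      ((k : ℤ) + 1) * Cayley.hMixed e V R (k + 1)
          + ((d : ℤ) + R.card - 1 - k) * Cayley.hMixed e V R k
        = Cayley.hNum (d + R.card - 2) (Cayley.incidenceCount e V R) k := by
    intro k hk
    rw [Cayley.hMixed, Cayley.hMixed, Cayley.facesDim_mixedFaces hd hV hsimp hR, hδ]
    exact Cayley.hNum_derivative hinc (by omega)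
  refine ⟨?_, fun k hk => ?_, fun k hk => ?_⟩
  · rw [Cayley.sum_hFacesGen_mixedLink hV hsimp hR, Cayley.hMixedGen,
      Cayley.facesDim_mixedFaces hd hV hsimp hR, hδ]
    exact Cayley.hGen_derivative hinc
  · rw [hlhs k hk, Cayley.sum_hFaces_mixedLink hV hsimp hR]
  · rw [hlhs k hk, Cayley.sum_gFaces_link hd hV hsimp]
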